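/- Let $p$ be a real-valued $C^\infty$ function near $0\in\mathbb{R}$ and $q$ a real-valued $C^\infty$ function near $0\in\mathbb{R}^2$ with expansions $$p(y)=p_3y^3+p_4y^4+O(5),\qquad q(x,y)=\sum_{k=0}^{3}q_{3k}x^{3-k}y^k+\sum_{k=0}^{4}q_{4k}x^{4-k}y^k+O(5),$$ let $a,b\in\mathbb{R}$, and let $$\phi(x,y)=\bigl(x,\;xy+p(y),\;ax^2+bxy+y^2+q(x,y)\bigr)$$ be the corresponding geometric cross-cap. For a unit vector $\eta\in\mathbb{S}^2$ and $\delta\in\mathbb{R}$ let $W_{(\eta,\delta)}=\{v\in\mathbb{R}^3:\langle v,\eta\rangle=\delta\}$, and let $$f_{(\eta,\delta)}(x,y)=\phi(x,y)+\bigl(\langle\eta,\phi(x,y)\rangle-\delta\bigr)\bigl(\langle\eta,\phi(x,y)\rangle-\delta-1\bigr)\eta$$ be the folding map on the cross-cap with respect to $W_{(\eta,\delta)}$. Then for every $(\eta,\delta)\in\mathbb{S}^2\times\mathbb{R}$ the map $f_{(\eta,\delta)}$ is singular at the origin, that is, its differential at $(0,0)$ has rank less than $2$. This singularity is more degenerate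 than a cross-cap if and only if the plane $W_{(\eta,\delta)}$ contains the origin, that is, if and only if $\delta=0$. Here a map germ at a point of $\mathbb{R}^2$ with values in $\mathbb{R}^3$ has a cross-cap singularity if, up to germs of $C^\infty$ diffeomorphisms in the source and in the target (carrying base points to base points), it is the germ at $0$ of $(x,y)\mapsto(x,xy,y^2)$; a singular germ is more degenerate than a cross-cap if it does not have a cross-cap singularity. -/

import Mathlib

open Filter Topology Asymptotics
open scoped ContDiff

/-- Euclidean 3-space. -/
abbrev E3 : Type := EuclideanSpace ℝ (Fin 3)

/-- `f` represents a `C^∞` germ at `x`: it is `C^∞` on a neighbourhood of `x`. (Smoothness is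
required at all points near `x`, as `ContDiffAt ℝ ∞ f x` alone does not give a common neighbourhood
for all orders of differentiability.) -/
def SmoothGermAt {E F : Type*} [NormedAddCommGroup E] [NormedSpace ℝ E]
    [NormedAddCommGroup F] [NormedSpace ℝ F] (f : E → F) (x : E) : Prop :=
  ∀ᶠ z in 𝓝 x, ContDiffAt ℝ ∞ f z

/-- `h` represents a germ of diffeomorphism `(E, x) → (F, y)`: a smooth germ with `h x = y` that has
a smooth inverse germ. -/
def IsDiffeoGerm {E F : Type*} [NormedAddCommGroup E] [NormedSpace ℝ E]
    [NormedAddCommGroup F] [NormedSpace ℝ F] (h : E → F) (x : E) (y : F) : Prop :=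
  h x = y ∧ SmoothGermAt h x ∧
    ∃ g : F → E, g y = x ∧ SmoothGermAt g y ∧
      (∀ᶠ z in 𝓝 x, g (h z) = z) ∧ (∀ᶠ w in 𝓝 y, h (g w) = w)

/-- `𝒜`-equivalence of the germ of `f` at `x` and the germ of `g` at `x'`: there are germs of
diffeomorphisms `h : (E, x) → (E, x')` and `k : (F, f x) → (F, g x')` with `k ∘ f = g ∘ h` near `x`.
The base points in the target are `f x` and `g x'`; when both are the origin this is `𝒜`-equivalence
of germs `(E, 0) → (F, 0)`. -/
def AEquivalent {E F : Type*} [NormedAddCommGroup E] [NormedSpace ℝ E]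
    [NormedAddCommGroup F] [NormedSpace ℝ F] (f : E → F) (x : E) (g : E → F) (x' : E) : Prop :=
  ∃ (h : E → E) (k : F → F), IsDiffeoGerm h x x' ∧ IsDiffeoGerm k (f x) (g x') ∧
    ∀ᶠ z in 𝓝 x, k (f z) = g (h z)

/-- The model `(x, y) ↦ (x, x y, y²)` of the cross-cap singularity. -/
noncomputable def crossCapModel (z : ℝ × ℝ) : E3 :=
  !₂[z.1, z.1 * z.2, z.2 ^ 2]

/-- The germ of `g` at `x` has a cross-cap singularity. -/
def HasCrossCapAt (g : ℝ × ℝ → E3) (x : ℝ × ℝ) : Prop :=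
  AEquivalent crossCapModel 0 g x

/-- `g` is singular at `x`: it is differentiable there and its differential has rank less than `2`,
that is, it is not injective. -/
def IsSingularAt (g : ℝ × ℝ → E3) (x : ℝ × ℝ) : Prop :=
  ∃ g' : ℝ × ℝ →L[ℝ] E3, HasFDerivAt g g' x ∧ ¬ Function.Injective g'

/-- The germ of `g` at `x` has a singularity which is more degenerate than a cross-cap: it is
singular, and it is not a cross-cap (the least degenerate singularity). -/
def IsMoreDegenerateThanCrossCapAt (g : ℝ × ℝ → E3) (x : ℝ × ℝ) : Prop :=
  IsSingularAt g x ∧ ¬ HasCrossCapAt g x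

/-- The data of a geometric cross-cap
`φ(x, y) = (x, x y + p(y), a x² + b x y + y² + q(x, y))`, where `p` and `q` are smooth germs with
`p(y) = p₃ y³ + p₄ y⁴ + O(5)` and
`q(x, y) = ∑_{k ≤ 3} q_{3k} x^{3-k} y^k + ∑_{k ≤ 4} q_{4k} x^{4-k} y^k + O(5)`. -/
structure GeometricCrossCap where
  a : ℝ
  b : ℝ
  p : ℝ → ℝ
  q : ℝ × ℝ → ℝ
  smooth_p : SmoothGermAt p 0
  smooth_q : SmoothGermAt q 0
  expansion_p : ∃ p₃ p₄ : ℝ,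
    (fun y : ℝ => p y - (p₃ * y ^ 3 + p₄ * y ^ 4)) =O[𝓝 0] (fun y : ℝ => y ^ 5)
  expansion_q : ∃ q₃ q₄ : ℕ → ℝ,
    (fun z : ℝ × ℝ => q z - ((∑ k ∈ Finset.range 4, q₃ k * z.1 ^ (3 - k) * z.2 ^ k)
      + ∑ k ∈ Finset.range 5, q₄ k * z.1 ^ (4 - k) * z.2 ^ k)) =O[𝓝 0]
    (fun z : ℝ × ℝ => ‖z‖ ^ 5)

/-- The parametrization `φ` of a geometric cross-cap. -/
noncomputable def GeometricCrossCap.param (C : GeometricCrossCap) (z : ℝ × ℝ) : E3 :=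
  !₂[z.1, z.1 * z.2 + C.p z.2, C.a * z.1 ^ 2 + C.b * z.1 * z.2 + z.2 ^ 2 + C.q z]

/-- The plane `W_{(η, δ)} = {p | ⟨p, η⟩ = δ}`. -/
def foldingPlane (η : Metric.sphere (0 : E3) 1) (δ : ℝ) : Set E3 :=
  {p | inner ℝ p (η : E3) = δ}

/-- The folding map of `ℝ³` with respect to `W_{(η, δ)}`: `p ↦ q + t² η`, where
`t = ⟨η, p⟩ - δ` is the signed distance from `p` to the plane and `q = p - t η` is the orthogonal
projection of `p` to the plane; so `p ↦ p + t (t - 1) η`. -/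
noncomputable def foldingMap (η : Metric.sphere (0 : E3) 1) (δ : ℝ) (p : E3) : E3 :=
  p + ((inner ℝ (η : E3) p - δ) * (inner ℝ (η : E3) p - δ - 1)) • (η : E3)

/-- The folding map `f_{(η, δ)} = F(·, ·, η, δ)` on a geometric cross-cap. -/
noncomputable def GeometricCrossCap.folding (C : GeometricCrossCap)
    (η : Metric.sphere (0 : E3) 1) (δ : ℝ) (z : ℝ × ℝ) : E3 :=
  foldingMap η δ (C.param z)

/-! The differential of `φ` at 0 is `dx ⊗ e₀`, which kills `(0, 1)`; hence every composite with the
folding map is singular. Degeneracy depends on the differential of the folding map at 0, which is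
`id - (1 + 2δ) η ⊗ η`: the identity on the orthogonal complement of `η` and multiplication by `-2δ`
on `η`.

If `δ ≠ 0`, the folding map is a local diffeomorphism, so it suffices that `φ` itself is a
cross-cap. A parametrized Morse lemma (`SmoothGermAt.exists_morse`) writes the third component as
`m(x) + V²`. In the coordinates `(x, u)` with `u = V(x, y)`, Whitney's division theorem
(`SmoothGermAt.exists_fold_decomposition`) turns the second component into `A(x, u²) + u B(x, u²)`.
Since `p` vanishes to order 3, `∂B/∂x(0) ≠ 0`, so `(B, u)` are source coordinates. Because `m`, `A`
and `B` depend only on `x` and `u²`, target coordinates absorb them and leave the model. Division is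
proved by Fourier inversion: the even functions `cos t` and `sin t / t` are smooth in `t²`.

If `δ = 0`, then `⟨η, f⟩ = ⟨η, φ⟩²`. An equivalence `k ∘ model = f ∘ h` would make `L = ⟨η, k⟩` a
submersion whose restriction to the model is `T²`, with `T = ⟨η, φ ∘ h⟩`. Since `dh` preserves the
kernel direction, `∂T/∂y(0) = 0`, and comparison along curves in the model forces `dL(0) = 0`
(`fderiv_eq_zero_of_comp_crossCapModel_eq_sq`), a contradiction. -/

/-! ### Calculus of smooth germs, diffeomorphism germs and `𝒜`-equivalence. -/

section Germs

variable {E F G : Type*} [NormedAddCommGroup E] [NormedSpace ℝ E]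
  [NormedAddCommGroup F] [NormedSpace ℝ F] [NormedAddCommGroup G] [NormedSpace ℝ G]

theorem ContDiff.smoothGermAt {f : E → F} (hf : ContDiff ℝ ∞ f) (x : E) : SmoothGermAt f x :=
  Eventually.of_forall fun _ => hf.contDiffAt

theorem SmoothGermAt.contDiffAt {f : E → F} {x : E} (hf : SmoothGermAt f x) :
    ContDiffAt ℝ ∞ f x := hf.self_of_nhds

theorem SmoothGermAt.continuousAt {f : E → F} {x : E} (hf : SmoothGermAt f x) :
    ContinuousAt f x := hf.contDiffAt.continuousAt

theorem SmoothGermAt.differentiableAt {f : E → F} {x : E} (hf : SmoothGermAt f x) :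
    DifferentiableAt ℝ f x := hf.contDiffAt.differentiableAt (by simp)

theorem SmoothGermAt.hasStrictFDerivAt {f : E → F} {x : E} (hf : SmoothGermAt f x) :
    HasStrictFDerivAt f (fderiv ℝ f x) x := hf.contDiffAt.hasStrictFDerivAt (by simp)

theorem SmoothGermAt.congr {f g : E → F} {x : E} (hf : SmoothGermAt f x) (h : f =ᶠ[𝓝 x] g) :
    SmoothGermAt g x := by
  filter_upwards [hf, h.eventuallyEq_nhds] with z hz hz' using hz.congr_of_eventuallyEq hz'.symm

theorem SmoothGermAt.comp {f : E → F} {g : F → G} {x : E} {y : F} (hg : SmoothGermAt g y)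
    (hf : SmoothGermAt f x) (hxy : f x = y) : SmoothGermAt (fun z => g (f z)) x := by
  subst hxy
  filter_upwards [hf, hf.continuousAt.eventually hg] with z h1 h2 using h2.comp z h1

theorem SmoothGermAt.prodMk {f : E → F} {g : E → G} {x : E} (hf : SmoothGermAt f x)
    (hg : SmoothGermAt g x) : SmoothGermAt (fun z => (f z, g z)) x := by
  filter_upwards [hf, hg] with z h1 h2 using h1.prodMk h2

theorem SmoothGermAt.add {f g : E → F} {x : E} (hf : SmoothGermAt f x)
    (hg : SmoothGermAt g x) : SmoothGermAt (fun z => f z + g z) x := by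
  filter_upwards [hf, hg] with z h1 h2 using h1.add h2

theorem SmoothGermAt.mul {f g : E → ℝ} {x : E} (hf : SmoothGermAt f x)
    (hg : SmoothGermAt g x) : SmoothGermAt (fun z => f z * g z) x := by
  filter_upwards [hf, hg] with z h1 h2 using h1.mul h2

theorem SmoothGermAt.fderiv_apply {f : E → F} {x : E} (hf : SmoothGermAt f x) (v : E) :
    SmoothGermAt (fun z => fderiv ℝ f z v) x := by
  filter_upwards [hf] with z hz
  exact (hz.fderiv_right (m := ∞) (by simp)).clm_apply contDiffAt_const

theorem IsDiffeoGerm.refl (x : E) : IsDiffeoGerm (fun z : E => z) x x :=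
  ⟨rfl, contDiff_id.smoothGermAt x, fun z => z, rfl, contDiff_id.smoothGermAt x,
    Eventually.of_forall fun _ => rfl, Eventually.of_forall fun _ => rfl⟩

theorem IsDiffeoGerm.trans {h : E → F} {k : F → G} {x : E} {y : F} {z : G}
    (hh : IsDiffeoGerm h x y) (hk : IsDiffeoGerm k y z) : IsDiffeoGerm (fun w => k (h w)) x z := by
  obtain ⟨h1, h2, g, g1, g2, g3, g4⟩ := hh
  obtain ⟨k1, k2, l, l1, l2, l3, l4⟩ := hk
  refine ⟨by simp only [h1, k1], k2.comp h2 h1, fun w => g (l w), by simp only [l1, g1], g2.comp l2 l1, ?_, ?_⟩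
  · have : Tendsto h (𝓝 x) (𝓝 y) := h1 ▸ h2.continuousAt
    filter_upwards [g3, this.eventually l3] with w a b
    rw [b, a]
  · have : Tendsto l (𝓝 z) (𝓝 y) := l1 ▸ l2.continuousAt
    filter_upwards [l4, this.eventually g4] with w a b
    rw [b, a]

theorem IsDiffeoGerm.exists_inverse {h : E → F} {x : E} {y : F} (hh : IsDiffeoGerm h x y) :
    ∃ g : F → E, IsDiffeoGerm g y x ∧ (∀ᶠ z in 𝓝 x, g (h z) = z) ∧ ∀ᶠ w in 𝓝 y, h (g w) = w := by
  obtain ⟨h1, h2, g, g1, g2, g3, g4⟩ := hh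
  exact ⟨g, ⟨g1, g2, h, h1, h2, g4, g3⟩, g3, g4⟩

theorem IsDiffeoGerm.tendsto {h : E → F} {x : E} {y : F} (hh : IsDiffeoGerm h x y) :
    Tendsto h (𝓝 x) (𝓝 y) := hh.1 ▸ hh.2.1.continuousAt

/-- The differential of a germ of diffeomorphism is injective. -/
theorem IsDiffeoGerm.fderiv_injective {h : E → F} {x : E} {y : F} (hh : IsDiffeoGerm h x y) :
    Function.Injective (fderiv ℝ h x) := by
  obtain ⟨h1, h2, g, g1, g2, g3, g4⟩ := hh
  subst h1
  have hc := g2.differentiableAt.hasFDerivAt.comp x h2.differentiableAt.hasFDerivAt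
  have := (hc.congr_of_eventuallyEq (f₁ := id) (g3.mono fun z hz => hz.symm)).unique
    (hasFDerivAt_id x)
  intro a b hab
  have e := fun v => DFunLike.congr_fun this v
  simp only [ContinuousLinearMap.comp_apply, ContinuousLinearMap.id_apply] at e
  rw [← e a, ← e b, hab]

/-- The differential of a germ of diffeomorphism is surjective. -/
theorem IsDiffeoGerm.fderiv_surjective {h : E → F} {x : E} {y : F} (hh : IsDiffeoGerm h x y) :
    Function.Surjective (fderiv ℝ h x) := by
  obtain ⟨h1, h2, g, g1, g2, g3, g4⟩ := hh
  subst h1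
  have hd : HasFDerivAt h (fderiv ℝ h x) (g (h x)) := by
    rw [g1]; exact h2.differentiableAt.hasFDerivAt
  have hc := hd.comp (h x) g2.differentiableAt.hasFDerivAt
  have := (hc.congr_of_eventuallyEq (f₁ := id) (g4.mono fun z hz => hz.symm)).unique
    (hasFDerivAt_id _)
  intro b
  exact ⟨_, DFunLike.congr_fun this b⟩

/-- Inverse function theorem for smooth germs. -/
theorem IsDiffeoGerm.of_hasFDerivAt [CompleteSpace E] {h : E → F} {x : E} {y : F}
    (hxy : h x = y) (hs : SmoothGermAt h x) (e : E ≃L[ℝ] F) (he : HasFDerivAt h (e : E →L[ℝ] F) x) :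
    IsDiffeoGerm h x y := by
  subst hxy
  set P := hs.contDiffAt.toOpenPartialHomeomorph h he (by simp) with hP
  have hPh : (P : E → F) = h := rfl
  have hxs : x ∈ P.source := hs.contDiffAt.mem_toOpenPartialHomeomorph_source he (by simp)
  have hyt : h x ∈ P.target := hs.contDiffAt.image_mem_toOpenPartialHomeomorph_target he (by simp)
  have hgx : P.symm (h x) = x := P.left_inv hxs
  have hleft : ∀ᶠ z in 𝓝 x, P.symm (h z) = z := by
    filter_upwards [P.open_source.mem_nhds hxs] with z hz using P.left_inv hz
  have hright : ∀ᶠ w in 𝓝 (h x), h (P.symm w) = w := by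
    filter_upwards [P.open_target.mem_nhds hyt] with w hw using P.right_inv hw
  refine ⟨rfl, hs, P.symm, hgx, ?_, hleft, hright⟩
  -- Invertibility of the differential is an open condition, so the local inverse is smooth on a
  -- neighbourhood and not merely at the base point.
  have hinv : ∀ᶠ z in 𝓝 x, ∃ e' : E ≃L[ℝ] F, HasFDerivAt h (e' : E →L[ℝ] F) z := by
    have hcont : ContinuousAt (fderiv ℝ h) x :=
      (hs.contDiffAt.fderiv_right (m := 0) (by simp)).continuousAt
    have hopen := e.nhds
    have hmem : Set.range ((↑) : (E ≃L[ℝ] F) → E →L[ℝ] F) ∈ 𝓝 (fderiv ℝ h x) := by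
      rw [he.fderiv]; exact hopen
    filter_upwards [hcont.eventually hmem, hs] with z hz hz'
    obtain ⟨e', he'⟩ := hz
    exact ⟨e', he' ▸ (hz'.differentiableAt (by simp)).hasFDerivAt⟩
  have htend : Tendsto P.symm (𝓝 (h x)) (𝓝 x) := by
    have := P.symm.continuousAt hyt
    rwa [ContinuousAt, hgx] at this
  filter_upwards [htend.eventually hinv, htend.eventually hs, P.open_target.mem_nhds hyt]
    with w ⟨e', he'⟩ hw hwt
  exact P.contDiffAt_symm hwt he' hw

theorem AEquivalent.symm {f g : E → F} {x x' : E} (H : AEquivalent f x g x')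
    (hfc : ContinuousAt f x) : AEquivalent g x' f x := by
  obtain ⟨h, k, hh, hk, H⟩ := H
  obtain ⟨h', hh', h1, h2⟩ := hh.exists_inverse
  obtain ⟨k', hk', k1, k2⟩ := hk.exists_inverse
  refine ⟨h', k', hh', hk', ?_⟩
  filter_upwards [h2, hh'.tendsto.eventually H, (hfc.tendsto.comp hh'.tendsto).eventually k1]
    with z a b c
  rw [a] at b
  rw [← b]; exact c

theorem AEquivalent.trans {f g l : E → F} {x x' x'' : E} (H : AEquivalent f x g x')
    (H' : AEquivalent g x' l x'') : AEquivalent f x l x'' := by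
  obtain ⟨h, k, hh, hk, H⟩ := H
  obtain ⟨h', k', hh', hk', H'⟩ := H'
  refine ⟨fun z => h' (h z), fun w => k' (k w), hh.trans hh', hk.trans hk', ?_⟩
  filter_upwards [H, hh.tendsto.eventually H'] with z a b
  rw [a, b]

theorem IsDiffeoGerm.aequivalent_target {f : E → F} {k : F → F} {x : E} {y : F}
    (hk : IsDiffeoGerm k (f x) y) : AEquivalent f x (fun z => k (f z)) x :=
  ⟨fun z => z, k, IsDiffeoGerm.refl _, by simpa only [hk.1] using hk,
    Eventually.of_forall fun _ => rfl⟩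

end Germs

/-! ### A bounded smooth kernel extending `cos √w`. -/

/-- The entire function `w ↦ ∑ (-w)ᵏ / (2k)!`, which extends `cos √w` to the real line. -/
theorem exists_contDiff_cos_sqrt :
    ∃ c : ℝ → ℝ, ContDiff ℝ ∞ c ∧ ∀ u, c (u ^ 2) = Real.cos u := by
  set a : ℕ → ℝ := fun k => (-1) ^ k / (2 * k).factorial with ha
  have ha0 : ∀ k, a k ≠ 0 := fun k => by simp [ha, Nat.factorial_ne_zero]
  have hrad : (FormalMultilinearSeries.ofScalars ℝ a).radius = ⊤ := by
    apply FormalMultilinearSeries.ofScalars_radius_eq_top_of_tendsto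
    · exact Eventually.of_forall ha0
    · have hle : ∀ n : ℕ, ‖a n.succ‖ / ‖a n‖ ≤ 1 / ((n : ℝ) + 1) := by
        intro n
        have hn : ((2 * (n + 1)).factorial : ℝ) = (2 * n + 2) * (2 * n + 1) * (2 * n).factorial := by
          rw [show 2 * (n + 1) = (2 * n + 1) + 1 by ring, Nat.factorial_succ, Nat.factorial_succ]
          push_cast; ring
        have h1 : ((2 * n).factorial : ℝ) ≠ 0 := by exact_mod_cast Nat.factorial_ne_zero _
        simp only [ha, norm_div, norm_pow, norm_neg, norm_one, one_pow, Nat.succ_eq_add_one, hn,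
          Real.norm_eq_abs]
        rw [abs_of_pos (by positivity), abs_of_pos (by positivity)]
        rw [div_div_div_eq, one_mul, mul_one]
        rw [div_le_div_iff₀ (by positivity) (by positivity)]
        have : (0 : ℝ) < (2 * n).factorial := by positivity
        nlinarith [mul_pos this (by positivity : (0 : ℝ) < (n + 1 : ℝ)),
          mul_nonneg this.le (by positivity : (0 : ℝ) ≤ (n : ℝ) * (n + 1 : ℝ))]
      exact squeeze_zero (fun n => by positivity) hle tendsto_one_div_add_atTop_nhds_zero_nat
  have hball := (FormalMultilinearSeries.ofScalars ℝ a).hasFPowerSeriesOnBall (by simp [hrad])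
  refine ⟨(FormalMultilinearSeries.ofScalars ℝ a).sum, ?_, fun u => ?_⟩
  · have := hball.analyticOnNhd
    rw [hrad] at this
    rw [← contDiffOn_univ]
    have h2 : AnalyticOnNhd ℝ (FormalMultilinearSeries.ofScalars ℝ a).sum Set.univ := by
      intro x _
      exact this x (by simp)
    exact h2.contDiffOn uniqueDiffOn_univ
  · rw [FormalMultilinearSeries.sum, ← (Real.hasSum_cos u).tsum_eq]
    refine tsum_congr fun n => ?_
    simp [FormalMultilinearSeries.ofScalars, ha, pow_mul]
    ring

/-- The entire extension of `cos √w` grows like `cosh √|w|` for negative `w`. Cutting it off there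
costs nothing, since only `w = u²` matters, and makes all derivatives bounded, as needed to
differentiate Fourier integrals over all frequencies. -/
theorem exists_bounded_cos_sqrt_kernel :
    ∃ K : ℕ → ℝ → ℝ, (∀ n w, HasDerivAt (K n) (K (n + 1) w) w) ∧
      (∀ n, ∃ M, ∀ w, |K n w| ≤ M) ∧ (∀ u, K 0 (u ^ 2) = Real.cos u) ∧
      ∀ u, -2 * u * K 1 (u ^ 2) = Real.sin u := by
  obtain ⟨c, hc, hcos⟩ := exists_contDiff_cos_sqrt
  -- The cutoff is 0 for `w ≤ -2` and 1 for `w ≥ -1`, hence 1 near every `w = u²`.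
  set C : ℝ → ℝ := fun w => Real.smoothTransition (w + 2) * c w with hC
  have hCsm : ContDiff ℝ ∞ C :=
    ((Real.smoothTransition.contDiff (n := ⊤)).comp (contDiff_id.add contDiff_const)).mul hc
  set K : ℕ → ℝ → ℝ := fun n => iteratedDeriv n C with hK
  have hder : ∀ n w, HasDerivAt (K n) (K (n + 1) w) w := by
    intro n w
    simp only [hK, iteratedDeriv_succ]
    exact ((hCsm.differentiable_iteratedDeriv n
      (by exact_mod_cast WithTop.coe_lt_top n)) w).hasDerivAt
  have h0 : ∀ u, K 0 (u ^ 2) = Real.cos u := by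
    intro u
    simp only [hK, iteratedDeriv_zero, hC]
    rw [Real.smoothTransition.one_of_one_le (by nlinarith [sq_nonneg u]), one_mul, hcos]
  have hsq : ∀ n u, HasDerivAt (fun u => K n (u ^ 2)) (K (n + 1) (u ^ 2) * (2 * u)) u := by
    intro n u
    have := (hder n (u ^ 2)).comp u (hasDerivAt_pow 2 u)
    simpa [Function.comp_def] using this
  have h1 : ∀ u, -2 * u * K 1 (u ^ 2) = Real.sin u := by
    intro u
    have hA := hsq 0 u
    rw [show (fun u => K 0 (u ^ 2)) = Real.cos from funext h0] at hA
    linarith [hA.unique (Real.hasDerivAt_cos u)]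
  have h2 : ∀ w, 0 < w → 4 * w * K 2 w + 2 * K 1 w + K 0 w = 0 := by
    intro w hw
    obtain ⟨u, rfl⟩ : ∃ u, w = u ^ 2 := ⟨√w, (Real.sq_sqrt hw.le).symm⟩
    have hA := ((hasDerivAt_id u).const_mul (-2)).mul (hsq 1 u)
    have hB : ((fun u => -2 * id u) * fun u => K 1 (u ^ 2)) = Real.sin := by
      ext u; simpa using h1 u
    rw [hB] at hA
    have := hA.unique (Real.hasDerivAt_sin u)
    simp only [id] at this
    rw [h0]
    linarith
  -- The second-order equation `h2` differentiated `n` times.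
  have h3 : ∀ n : ℕ, ∀ w, 0 < w → 4 * w * K (n + 2) w + (4 * n + 2) * K (n + 1) w + K n w = 0 := by
    intro n
    induction n with
    | zero => simpa using h2
    | succ n ih =>
      intro w hw
      have hA := ((((hasDerivAt_id w).const_mul 4).mul (hder (n + 2) w)).add
        ((hder (n + 1) w).const_mul (4 * (n : ℝ) + 2))).add (hder n w)
      have hB : HasDerivAt (fun _ : ℝ => (0 : ℝ)) 0 w := hasDerivAt_const _ _
      have hev : (fun _ : ℝ => (0 : ℝ)) =ᶠ[𝓝 w] ((fun y => 4 * id y) * K (n + 2) +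
          fun y => (4 * (n : ℝ) + 2) * K (n + 1) y) + K n := by
        filter_upwards [lt_mem_nhds hw] with y hy
        simpa using (ih y hy).symm
      have := (hA.congr_of_eventuallyEq hev).unique hB
      simp only [id] at this
      push_cast
      linarith
  have hleft : ∀ n : ℕ, ∀ w, w < -2 → K n w = 0 := by
    intro n
    induction n with
    | zero =>
      intro w hw
      simp [hK, hC, Real.smoothTransition.zero_of_nonpos (show w + 2 ≤ 0 by linarith)]
    | succ n ih =>
      intro w hw
      refine ((hder n w).congr_of_eventuallyEq (f₁ := fun _ => (0 : ℝ)) ?_).unique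
        (hasDerivAt_const _ _)
      filter_upwards [gt_mem_nhds hw] with y hy using (ih y hy).symm
  -- The recursion `h3` has two predecessors, so consecutive bounds are carried together; on `w ≥ 1`
  -- the leading factor `4w` can be divided out.
  have hright : ∀ n : ℕ, (∃ M, ∀ w, 1 ≤ w → |K n w| ≤ M) ∧ ∃ M, ∀ w, 1 ≤ w → |K (n + 1) w| ≤ M := by
    intro n
    induction n with
    | zero =>
      refine ⟨⟨1, fun w hw => ?_⟩, ⟨1, fun w hw => ?_⟩⟩
      · have := h0 (√w)
        rw [Real.sq_sqrt (by linarith)] at this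
        rw [this]; exact Real.abs_cos_le_one _
      · have := h1 (√w)
        rw [Real.sq_sqrt (by linarith)] at this
        have hs : 1 ≤ √w := Real.one_le_sqrt.mpr hw
        have hb := Real.abs_sin_le_one (√w)
        rw [← this, abs_mul, abs_mul, abs_of_nonneg (by linarith : (0 : ℝ) ≤ √w)] at hb
        norm_num at hb ⊢
        nlinarith [abs_nonneg (K 1 w)]
    | succ n ih =>
      obtain ⟨⟨M, hM⟩, M', hM'⟩ := ih
      refine ⟨⟨M', hM'⟩, (4 * n + 2) * M' + M, fun w hw => ?_⟩
      have := h3 n w (by linarith)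
      have e : 4 * w * K (n + 2) w = -((4 * n + 2) * K (n + 1) w + K n w) := by linarith
      have e2 : 4 * w * |K (n + 2) w| = |(4 * n + 2) * K (n + 1) w + K n w| := by
        rw [← abs_neg ((4 * n + 2) * K (n + 1) w + K n w), ← e, abs_mul, abs_of_pos (by linarith : 0 < 4 * w)]
      have e3 : |(4 * n + 2) * K (n + 1) w + K n w| ≤ (4 * n + 2) * M' + M := by
        refine (abs_add_le _ _).trans (add_le_add ?_ (hM w hw))
        rw [abs_mul, abs_of_nonneg (by positivity)]
        exact mul_le_mul_of_nonneg_left (hM' w hw) (by positivity)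
      show |K (n + 2) w| ≤ _
      nlinarith [abs_nonneg (K (n + 2) w)]
  refine ⟨K, hder, fun n => ?_, h0, h1⟩
  obtain ⟨M, hM⟩ := (hright n).1
  have hcont : Continuous (K n) :=
    continuous_iff_continuousAt.mpr fun w => (hder n w).continuousAt
  obtain ⟨M', hM'⟩ := (isCompact_Icc (a := (-2 : ℝ)) (b := 1)).exists_bound_of_continuousOn
    hcont.continuousOn
  refine ⟨max (max M M') 0, fun w => ?_⟩
  rcases lt_or_ge w (-2) with hw | hw
  · simp [hleft n w hw]
  · rcases le_total w 1 with hw' | hw'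
    · exact (hM' w ⟨hw, hw'⟩).trans (by simp)
    · exact (hM w hw').trans (by simp)

open MeasureTheory FourierTransform

/-- A smooth germ is represented by a smooth function with compact support. -/
theorem SmoothGermAt.exists_hasCompactSupport {E F : Type*} [NormedAddCommGroup E]
    [NormedSpace ℝ E] [FiniteDimensional ℝ E] [NormedAddCommGroup F] [NormedSpace ℝ F]
    {g : E → F} {x : E} (hg : SmoothGermAt g x) :
    ∃ G : E → F, ContDiff ℝ ∞ G ∧ HasCompactSupport G ∧ G =ᶠ[𝓝 x] g := by
  obtain ⟨r, hr, hball⟩ := Metric.eventually_nhds_iff_ball.mp hg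
  let χ : ContDiffBump x := ⟨r / 4, r / 2, by positivity, by linarith⟩
  have hχ : HasCompactSupport χ := χ.hasCompactSupport
  refine ⟨fun z => χ z • g z, ?_, hχ.smul_right, ?_⟩
  · rw [contDiff_iff_contDiffAt]
    intro z
    by_cases hz : z ∉ tsupport fun z => χ z • g z
    · exact contDiffAt_const.congr_of_eventuallyEq (notMem_tsupport_iff_eventuallyEq.mp hz)
    rw [not_not] at hz
    have hz' : z ∈ tsupport χ := closure_mono (Function.support_smul_subset_left _ _) hz
    rw [χ.tsupport_eq, Metric.mem_closedBall] at hz'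
    have : dist z x ≤ r / 2 := hz'
    exact χ.contDiffAt.smul (hball z (by rw [Metric.mem_ball]; linarith))
  · filter_upwards [χ.eventuallyEq_one] with z hz
    rw [hz]; simp

/-! ### Superpositions of plane waves in `x` with the kernel in `z`. -/

section Kernel

/-- The Euclidean plane of frequencies. -/
abbrev E2 : Type := EuclideanSpace ℝ (Fin 2)

/-- A continuous function with finite absolute moments of all orders. -/
def RapidlyDecaying (F : E2 → ℂ) : Prop :=
  Continuous F ∧ ∀ k : ℕ, Integrable fun v => ‖v‖ ^ k * ‖F v‖

theorem RapidlyDecaying.mul_coord {F : E2 → ℂ} (hF : RapidlyDecaying F) (c : ℂ) (i : Fin 2) :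
    RapidlyDecaying fun v => c * (v i : ℂ) * F v := by
  refine ⟨by have := hF.1; fun_prop, fun k => ?_⟩
  refine ((hF.2 (k + 1)).const_mul ‖c‖).mono' ?_ (Eventually.of_forall fun v => ?_)
  · have := hF.1
    exact (by fun_prop : Continuous fun v : E2 => ‖v‖ ^ k * ‖c * (v i : ℂ) * F v‖).aestronglyMeasurable
  · have : |v i| ≤ ‖v‖ := by simpa using PiLp.norm_apply_le v i
    rw [Real.norm_of_nonneg (by positivity), norm_mul, norm_mul, Complex.norm_real, Real.norm_eq_abs]
    calc ‖v‖ ^ k * (‖c‖ * |v i| * ‖F v‖) ≤ ‖v‖ ^ k * (‖c‖ * ‖v‖ * ‖F v‖) := by gcongr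
      _ = _ := by ring

theorem RapidlyDecaying.integrable {F : E2 → ℂ} (hF : RapidlyDecaying F) : Integrable F := by
  have := hF.2 0
  simp only [pow_zero, one_mul] at this
  exact (integrable_norm_iff hF.1.aestronglyMeasurable).mp this

theorem SchwartzMap.rapidlyDecaying (f : SchwartzMap E2 ℂ) : RapidlyDecaying f :=
  ⟨f.continuous, fun k => f.integrable_pow_mul _ k⟩

/-- The integrand of the representation of functions of `(x, z)` by plane waves in `x` and the
kernel `K` in `z`. -/
noncomputable def waveKernel (K : ℝ → ℝ) (p : ℝ × ℝ) (v : E2) : ℂ :=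
  Complex.exp (2 * Real.pi * Complex.I * v 0 * p.1) * (K ((2 * Real.pi * v 1) ^ 2 * p.2) : ℂ)

/-- Superposition of the waves `waveKernel K` with density `F`. -/
noncomputable def waveIntegral (K : ℝ → ℝ) (F : E2 → ℂ) (p : ℝ × ℝ) : ℂ :=
  ∫ v, F v * waveKernel K p v

theorem norm_waveKernel (K : ℝ → ℝ) (p : ℝ × ℝ) (v : E2) :
    ‖waveKernel K p v‖ = |K ((2 * Real.pi * v 1) ^ 2 * p.2)| := by
  rw [waveKernel, norm_mul, Complex.norm_real, Real.norm_eq_abs,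
    show (2 * Real.pi * Complex.I * v 0 * p.1 : ℂ) = ((2 * Real.pi * v 0 * p.1 : ℝ) : ℂ) * Complex.I by
      push_cast; ring, Complex.norm_exp_ofReal_mul_I, one_mul]

theorem continuous_waveKernel {K : ℝ → ℝ} (hK : Continuous K) (p : ℝ × ℝ) :
    Continuous (waveKernel K p) := by
  unfold waveKernel; fun_prop

theorem RapidlyDecaying.integrable_mul_waveKernel {F : E2 → ℂ} (hF : RapidlyDecaying F)
    {K : ℝ → ℝ} (hK : Continuous K) {M : ℝ} (hM : ∀ w, |K w| ≤ M) (p : ℝ × ℝ) :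
    Integrable fun v => F v * waveKernel K p v :=
  hF.integrable.mul_bdd (c := M) (continuous_waveKernel hK p).aestronglyMeasurable
    (Eventually.of_forall fun v => by rw [norm_waveKernel]; exact hM _)

theorem hasFDerivAt_waveKernel {K K' : ℝ → ℝ} (hK : ∀ w, HasDerivAt K (K' w) w) (p : ℝ × ℝ)
    (v : E2) : HasFDerivAt (fun p => waveKernel K p v)
      ((ContinuousLinearMap.fst ℝ ℝ ℝ).smulRight
          ((2 * Real.pi * Complex.I) * v 0 * waveKernel K p v) +
        (ContinuousLinearMap.snd ℝ ℝ ℝ).smulRight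
          ((2 * Real.pi) * v 1 * ((2 * Real.pi) * v 1 * waveKernel K' p v))) p := by
  have h1 : HasDerivAt (fun x : ℝ => Complex.exp (2 * Real.pi * Complex.I * v 0 * x))
      (Complex.exp (2 * Real.pi * Complex.I * v 0 * p.1) *
        (2 * Real.pi * Complex.I * v 0 * 1)) p.1 :=
    ((Complex.ofRealCLM.hasDerivAt (x := p.1)).const_mul _).cexp
  have h2 : HasDerivAt (fun z : ℝ => (K ((2 * Real.pi * v 1) ^ 2 * z) : ℂ))
      ((K' ((2 * Real.pi * v 1) ^ 2 * p.2) * ((2 * Real.pi * v 1) ^ 2 * 1) : ℝ) : ℂ) p.2 :=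
    ((hK _).comp p.2 ((hasDerivAt_id p.2).const_mul _)).ofReal_comp
  have h1' := h1.hasFDerivAt.comp p (hasFDerivAt_fst (𝕜 := ℝ) (p := p))
  have h2' := h2.hasFDerivAt.comp p (hasFDerivAt_snd (𝕜 := ℝ) (p := p))
  refine (h1'.mul h2').congr_fderiv ?_
  ext1 <;> ext <;> simp [waveKernel] <;> ring

/-- Differentiation under the integral sign: `∂/∂x` brings down `2πi v₀`, while `∂/∂z` brings down
`(2π v₁)²` and replaces `K` by `K'`. Both factors are absorbed into the density, so the derivative
again consists of wave integrals. -/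
theorem hasFDerivAt_waveIntegral {K K' : ℝ → ℝ} (hK : ∀ w, HasDerivAt K (K' w) w)
    (hKb : ∃ M, ∀ w, |K w| ≤ M) (hK' : Continuous K') (hKb' : ∃ M, ∀ w, |K' w| ≤ M)
    {F : E2 → ℂ} (hF : RapidlyDecaying F) (p : ℝ × ℝ) :
    HasFDerivAt (waveIntegral K F)
      ((ContinuousLinearMap.smulRightL ℝ (ℝ × ℝ) ℂ (ContinuousLinearMap.fst ℝ ℝ ℝ))
          (waveIntegral K (fun v => (2 * Real.pi * Complex.I) * v 0 * F v) p) +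
        (ContinuousLinearMap.smulRightL ℝ (ℝ × ℝ) ℂ (ContinuousLinearMap.snd ℝ ℝ ℝ))
          (waveIntegral K' (fun v => (2 * Real.pi) * v 1 * ((2 * Real.pi) * v 1 * F v)) p)) p := by
  obtain ⟨M, hM⟩ := hKb
  obtain ⟨M', hM'⟩ := hKb'
  have hKc : Continuous K := continuous_iff_continuousAt.mpr fun w => (hK w).continuousAt
  set F₁ : E2 → ℂ := fun v => (2 * Real.pi * Complex.I) * v 0 * F v with hF₁
  set F₂ : E2 → ℂ := fun v => (2 * Real.pi) * v 1 * ((2 * Real.pi) * v 1 * F v) with hF₂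
  have r₁ : RapidlyDecaying F₁ := hF.mul_coord _ 0
  have r₂ : RapidlyDecaying F₂ := (hF.mul_coord (2 * Real.pi) 1).mul_coord (2 * Real.pi) 1
  set L₁ := ContinuousLinearMap.smulRightL ℝ (ℝ × ℝ) ℂ (ContinuousLinearMap.fst ℝ ℝ ℝ)
  set L₂ := ContinuousLinearMap.smulRightL ℝ (ℝ × ℝ) ℂ (ContinuousLinearMap.snd ℝ ℝ ℝ)
  have i₁ := r₁.integrable_mul_waveKernel hKc hM
  have i₂ := r₂.integrable_mul_waveKernel hK' hM'
  have hint : ∫ v, (L₁ (F₁ v * waveKernel K p v) + L₂ (F₂ v * waveKernel K' p v)) =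
      L₁ (waveIntegral K F₁ p) + L₂ (waveIntegral K' F₂ p) := by
    rw [integral_add (L₁.integrable_comp (i₁ p)) (L₂.integrable_comp (i₂ p)),
      L₁.integral_comp_comm (i₁ p), L₂.integral_comp_comm (i₂ p)]
    rfl
  rw [← hint]
  refine hasFDerivAt_integral_of_dominated_of_fderiv_le (s := Set.univ)
    (F' := fun p v => L₁ (F₁ v * waveKernel K p v) + L₂ (F₂ v * waveKernel K' p v))
    (bound := fun v => ‖L₁‖ * (‖F₁ v‖ * M) + ‖L₂‖ * (‖F₂ v‖ * M')) univ_mem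
    (Eventually.of_forall fun p => (hF.integrable_mul_waveKernel hKc hM p).aestronglyMeasurable)
    (hF.integrable_mul_waveKernel hKc hM p)
    ((L₁.integrable_comp (i₁ p)).add (L₂.integrable_comp (i₂ p))).aestronglyMeasurable ?_ ?_ ?_
  · refine Eventually.of_forall fun v p _ => (norm_add_le _ _).trans (add_le_add ?_ ?_)
    · refine (L₁.le_opNorm _).trans (mul_le_mul_of_nonneg_left ?_ (norm_nonneg _))
      rw [norm_mul, norm_waveKernel]
      exact mul_le_mul_of_nonneg_left (hM _) (norm_nonneg _)
    · refine (L₂.le_opNorm _).trans (mul_le_mul_of_nonneg_left ?_ (norm_nonneg _))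
      rw [norm_mul, norm_waveKernel]
      exact mul_le_mul_of_nonneg_left (hM' _) (norm_nonneg _)
  · exact ((r₁.integrable.norm.mul_const M).const_mul _).add
      ((r₂.integrable.norm.mul_const M').const_mul _)
  · refine Eventually.of_forall fun v p _ => ?_
    refine ((hasFDerivAt_waveKernel hK p v).const_mul (F v)).congr_fderiv ?_
    ext1 <;> ext <;> simp [L₁, L₂, hF₁, hF₂] <;> ring

/-- The class of densities is closed under multiplication by coordinates and the sequence `K` under
differentiation, so the order of smoothness is raised by induction with `n` and `F` varying. -/
theorem contDiff_waveIntegral {K : ℕ → ℝ → ℝ} (hK : ∀ n w, HasDerivAt (K n) (K (n + 1) w) w)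
    (hKb : ∀ n, ∃ M, ∀ w, |K n w| ≤ M) {F : E2 → ℂ} (hF : RapidlyDecaying F) (n : ℕ) :
    ContDiff ℝ ∞ (waveIntegral (K n) F) := by
  have hKc : ∀ n, Continuous (K n) := fun n =>
    continuous_iff_continuousAt.mpr fun w => (hK n w).continuousAt
  rw [contDiff_infty]
  intro m
  induction m generalizing n F with
  | zero =>
    exact contDiff_zero.mpr (continuous_iff_continuousAt.mpr fun p =>
      (hasFDerivAt_waveIntegral (hK n) (hKb n) (hKc _) (hKb _) hF p).continuousAt)
  | succ m ih =>
    refine contDiff_succ_iff_hasFDerivAt.mpr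
      ⟨_, ?_, hasFDerivAt_waveIntegral (hK n) (hKb n) (hKc _) (hKb _) hF⟩
    exact ((ContinuousLinearMap.contDiff _).comp (ih (hF.mul_coord _ 0) n)).add
      ((ContinuousLinearMap.contDiff _).comp
        (ih ((hF.mul_coord (2 * Real.pi) 1).mul_coord (2 * Real.pi) 1) (n + 1)))

end Kernel

/-! ### Whitney division and Hadamard's lemma. -/

/-- Division theorem for the fold `(x, u) ↦ (x, u²)` (Whitney): a smooth germ `g` can be written as
`g(x, u) = A(x, u²) + u B(x, u²)` with smooth `A` and `B`. -/
theorem SmoothGermAt.exists_fold_decomposition {g : ℝ × ℝ → ℝ} (hg : SmoothGermAt g 0) :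
    ∃ A B : ℝ × ℝ → ℝ, ContDiff ℝ ∞ A ∧ ContDiff ℝ ∞ B ∧
      ∀ᶠ z in 𝓝 0, g z = A (z.1, z.2 ^ 2) + z.2 * B (z.1, z.2 ^ 2) := by
  obtain ⟨G, hG, hGc, hGg⟩ := hg.exists_hasCompactSupport
  obtain ⟨K, hK, hKb, hK0, hK1⟩ := exists_bounded_cos_sqrt_kernel
  have hKc : ∀ n, Continuous (K n) := fun n =>
    continuous_iff_continuousAt.mpr fun w => (hK n w).continuousAt
  let e : E2 ≃L[ℝ] ℝ × ℝ :=
    (EuclideanSpace.equiv (Fin 2) ℝ).trans (ContinuousLinearEquiv.finTwoArrow ℝ ℝ)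
  have hcs : HasCompactSupport fun v : E2 => (G (e v) : ℂ) :=
    (hGc.comp_homeomorph e.toHomeomorph).comp_left Complex.ofReal_zero
  let S : SchwartzMap E2 ℂ := hcs.toSchwartzMap
    (Complex.ofRealCLM.contDiff.comp (hG.comp e.contDiff))
  let F : E2 → ℂ := (𝓕 S : SchwartzMap E2 ℂ)
  have hF : RapidlyDecaying F := (𝓕 S : SchwartzMap E2 ℂ).rapidlyDecaying
  -- With `t = 2π v₁ u`, `i sin t = -2i t K₁(t²)`; extracting the factor `u` leaves `-4πi v₁`.
  let F₁ : E2 → ℂ := fun v => (-4 * Real.pi * Complex.I) * v 1 * F v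
  have hF₁ : RapidlyDecaying F₁ := hF.mul_coord _ 1
  refine ⟨fun p => (waveIntegral (K 0) F p).re, fun p => (waveIntegral (K 1) F₁ p).re,
    Complex.reCLM.contDiff.comp (contDiff_waveIntegral hK hKb hF 0),
    Complex.reCLM.contDiff.comp (contDiff_waveIntegral hK hKb hF₁ 1), ?_⟩
  filter_upwards [hGg] with ⟨x, u⟩ hz
  rw [← hz]
  obtain ⟨M₀, hM₀⟩ := hKb 0
  obtain ⟨M₁, hM₁⟩ := hKb 1
  -- Fourier inversion, with `exp(it)` split into `cos t`, giving the part even in `u`, and `i sin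
  -- t`, giving the odd part.
  have key : (G (x, u) : ℂ) = waveIntegral (K 0) F (x, u ^ 2) + u * waveIntegral (K 1) F₁ (x, u ^ 2) := by
    have hinv : 𝓕⁻ (𝓕 S : SchwartzMap E2 ℂ) = S := FourierPair.fourierInv_fourier_eq S
    have h1 : (G (x, u) : ℂ) = (𝓕⁻ (𝓕 S : SchwartzMap E2 ℂ)) (!₂[x, u] : E2) := by
      rw [hinv]; simp [S, e]
    rw [h1, SchwartzMap.fourierInv_coe, Real.fourierInv_eq']
    unfold waveIntegral
    rw [← integral_const_mul, ← integral_add (hF.integrable_mul_waveKernel (hKc 0) hM₀ _)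
      ((hF₁.integrable_mul_waveKernel (hKc 1) hM₁ _).const_mul _)]
    refine integral_congr_ae (Eventually.of_forall fun v => ?_)
    have c0 := hK0 (2 * Real.pi * v 1 * u)
    have c1 := hK1 (2 * Real.pi * v 1 * u)
    rw [mul_pow] at c0 c1
    have hexp : Complex.exp ((2 * Real.pi * inner ℝ v (!₂[x, u] : E2) : ℝ) * Complex.I) =
        Complex.exp (2 * Real.pi * Complex.I * v 0 * x) *
          (Real.cos (2 * Real.pi * v 1 * u) + Real.sin (2 * Real.pi * v 1 * u) * Complex.I) := by
      rw [Complex.ofReal_cos, Complex.ofReal_sin, ← Complex.exp_mul_I, ← Complex.exp_add]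
      congr 1
      simp [PiLp.inner_apply, Fin.sum_univ_two]
      ring
    simp only [smul_eq_mul, waveKernel]
    rw [hexp, ← c0, ← c1]
    simp only [F₁, F]
    push_cast
    ring
  have := congrArg Complex.re key
  simpa using this

/-- Hadamard's lemma with a parameter. -/
theorem SmoothGermAt.exists_hadamard {g : ℝ × ℝ → ℝ} (hg : SmoothGermAt g 0) :
    ∃ g₁ : ℝ × ℝ → ℝ, ContDiff ℝ ∞ g₁ ∧ ∀ᶠ z in 𝓝 0, g z = g (z.1, 0) + z.2 * g₁ z := by
  obtain ⟨G, hG, hGc, hGg⟩ := hg.exists_hasCompactSupport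
  let χ : ContDiffBump (0 : ℝ) := ⟨1, 2, by norm_num, by norm_num⟩
  have hdG : ContDiff ℝ ∞ fun z => fderiv ℝ G z (0, 1) :=
    (hG.fderiv_right (m := ∞) (by simp)).clm_apply contDiff_const
  let f : ℝ → ℝ := Set.indicator (Set.Icc 0 1) fun _ => 1
  -- The Hadamard quotient `∫₀¹ ∂G/∂u(x, tu) dt` is written as the convolution at 0 of the indicator
  -- of `[0, 1]` with `k`, so smoothness of parametrized convolutions applies. The bump equals 1 on
  -- `[0, 1]` and provides compact support in `t`.
  let k : ℝ × ℝ → ℝ → ℝ := fun p t => χ (-t) * fderiv ℝ G (p.1, -t * p.2) (0, 1)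
  have hf : LocallyIntegrable f :=
    ((integrable_indicator_iff measurableSet_Icc).mpr (by simp)).locallyIntegrable
  have hk : ContDiff ℝ ∞ (Function.uncurry k) := by
    refine (χ.contDiff.comp contDiff_snd.neg).mul (hdG.comp ?_)
    exact (contDiff_fst.comp contDiff_fst).prodMk
      (contDiff_snd.neg.mul (contDiff_snd.comp contDiff_fst))
  have hsupp : ∀ p t, p ∈ (Set.univ : Set (ℝ × ℝ)) → t ∉ Metric.closedBall (0 : ℝ) 2 →
      k p t = 0 := by
    intro p t _ ht
    have : χ (-t) = 0 := χ.zero_of_le_dist (by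
      simp only [Metric.mem_closedBall, not_le, dist_zero_right, norm_neg] at ht ⊢
      exact ht.le)
    simp [k, this]
  have hconv := contDiffOn_convolution_right_with_param_comp (μ := volume) (n := ⊤)
    (ContinuousLinearMap.mul ℝ ℝ) (v := fun _ : ℝ × ℝ => (0 : ℝ)) contDiffOn_const isOpen_univ
    (isCompact_closedBall (0 : ℝ) 2) hsupp hf hk.contDiffOn
  refine ⟨_, contDiffOn_univ.mp hconv, ?_⟩
  have hcont : Tendsto (fun z : ℝ × ℝ => (z.1, (0 : ℝ))) (𝓝 0) (𝓝 0) :=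
    (by fun_prop : Continuous fun z : ℝ × ℝ => (z.1, (0 : ℝ))).tendsto' _ _ rfl
  filter_upwards [hGg, hcont.eventually hGg] with ⟨x, u⟩ h1 h2
  rw [← h1, ← h2]
  have hval : (MeasureTheory.convolution f (k (x, u)) (ContinuousLinearMap.mul ℝ ℝ) volume) 0 =
      ∫ t in (0 : ℝ)..1, fderiv ℝ G (x, t * u) (0, 1) := by
    rw [MeasureTheory.convolution, intervalIntegral.integral_of_le zero_le_one,
      ← integral_Icc_eq_integral_Ioc, ← integral_indicator measurableSet_Icc]
    refine integral_congr_ae (Eventually.of_forall fun t => ?_)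
    by_cases ht : t ∈ Set.Icc (0 : ℝ) 1
    · have : χ t = 1 := χ.one_of_mem_closedBall (by
        simp only [Metric.mem_closedBall, dist_zero_right, Real.norm_eq_abs]
        exact abs_le.mpr ⟨by linarith [ht.1], ht.2⟩)
      simp [f, k, ht, this]
    · simp [f, ht]
  rw [hval, ← intervalIntegral.integral_const_mul]
  have hderiv : ∀ t ∈ Set.uIcc (0 : ℝ) 1, HasDerivAt (fun t => G (x, t * u))
      (u * fderiv ℝ G (x, t * u) (0, 1)) t := by
    intro t _
    have hline : HasDerivAt (fun t : ℝ => (x, t * u)) ((0 : ℝ), 1 * u) t :=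
      (hasDerivAt_const t x).prodMk ((hasDerivAt_id t).mul_const u)
    have hGd : HasFDerivAt G (fderiv ℝ G (x, t * u)) (x, t * u) :=
      (hG.differentiable (by simp) _).hasFDerivAt
    have := hGd.comp_hasDerivAt t hline
    rw [show ((0 : ℝ), 1 * u) = u • ((0 : ℝ), (1 : ℝ)) by simp, map_smul, smul_eq_mul] at this
    exact this
  rw [intervalIntegral.integral_eq_sub_of_hasDerivAt hderiv]
  · simp
  · apply Continuous.intervalIntegrable
    exact continuous_const.mul (hdG.continuous.comp (by fun_prop))

/-! ### Low-order Taylor coefficients and the parametrized Morse lemma. -/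

theorem IsDiffeoGerm.of_fderiv_injective {E : Type*} [NormedAddCommGroup E] [NormedSpace ℝ E]
    [FiniteDimensional ℝ E] {h : E → E} {x y : E} (hxy : h x = y) (hs : SmoothGermAt h x)
    (hinj : ∀ v, fderiv ℝ h x v = 0 → v = 0) : IsDiffeoGerm h x y := by
  have : CompleteSpace E := FiniteDimensional.complete ℝ E
  have hi : Function.Injective (fderiv ℝ h x : E →ₗ[ℝ] E) :=
    (injective_iff_map_eq_zero _).mpr hinj
  refine .of_hasFDerivAt hxy hs (LinearEquiv.ofInjectiveEndo _ hi).toContinuousLinearEquiv ?_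
  exact hs.differentiableAt.hasFDerivAt.congr_fderiv (by ext v; rfl)

theorem eq_zero_of_pow_mul_isBigO {h : ℝ → ℝ} (hc : ContinuousAt h 0) (k : ℕ)
    (hO : (fun y => y ^ k * h y) =O[𝓝 0] fun y => y ^ (k + 1)) : h 0 = 0 := by
  obtain ⟨C, hC⟩ := hO.bound
  have h1 : Tendsto (fun y => |h y|) (𝓝[≠] 0) (𝓝 |h 0|) := (hc.tendsto.mono_left nhdsWithin_le_nhds).abs
  have h2 : Tendsto (fun y : ℝ => C * |y|) (𝓝[≠] 0) (𝓝 0) :=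
    ((by fun_prop : Continuous fun y : ℝ => C * |y|).tendsto' 0 0 (by simp)).mono_left
      nhdsWithin_le_nhds
  have h3 : ∀ᶠ y in 𝓝[≠] (0 : ℝ), |h y| ≤ C * |y| := by
    filter_upwards [nhdsWithin_le_nhds hC, self_mem_nhdsWithin] with y hy hy0
    have hp : 0 < |y| ^ k := pow_pos (abs_pos.mpr hy0) k
    simp only [norm_mul, norm_pow, Real.norm_eq_abs, pow_succ] at hy
    nlinarith
  exact abs_eq_zero.mp (le_antisymm (le_of_tendsto_of_tendsto h1 h2 h3) (abs_nonneg _))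

/-- A smooth germ with expansion `c y² + O(y³)` is `y² τ(y)` with `τ` smooth, `τ(0) = c`. -/
theorem SmoothGermAt.exists_eq_sq_mul {σ : ℝ → ℝ} (hσ : SmoothGermAt σ 0) {c : ℝ}
    (hO : (fun y => σ y - c * y ^ 2) =O[𝓝 0] fun y => y ^ 3) :
    ∃ τ : ℝ → ℝ, ContDiff ℝ ∞ τ ∧ τ 0 = c ∧ ∀ᶠ y in 𝓝 0, σ y = y ^ 2 * τ y := by
  have hs : SmoothGermAt (fun z : ℝ × ℝ => σ z.2) 0 :=
    SmoothGermAt.comp (y := (0 : ℝ)) hσ (contDiff_snd.smoothGermAt _) rfl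
  -- Two Hadamard divisions give `σ = σ(0) + a(0) y + b y²`; the expansion then determines the
  -- coefficients in increasing order.
  obtain ⟨a, ha, hsa⟩ := hs.exists_hadamard
  obtain ⟨b, hb, hab⟩ := (ha.smoothGermAt 0).exists_hadamard
  have hline : Tendsto (fun y : ℝ => ((0 : ℝ), y)) (𝓝 0) (𝓝 0) :=
    (by fun_prop : Continuous fun y : ℝ => ((0 : ℝ), y)).tendsto' _ _ rfl
  have hexp : ∀ᶠ y in 𝓝 (0 : ℝ), σ y = σ 0 + y * (a 0 + y * b (0, y)) := by
    filter_upwards [hline.eventually hsa, hline.eventually hab] with y h1 h2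
    rw [show σ y = σ 0 + y * a (0, y) from h1, show a (0, y) = a 0 + y * b (0, y) from h2]
  have hpow : ∀ k ≤ 3, (fun y : ℝ => y ^ 3) =O[𝓝 0] fun y => y ^ k := by
    intro k hk
    refine IsBigO.of_bound 1 ?_
    filter_upwards [Metric.closedBall_mem_nhds (0 : ℝ) one_pos] with y hy
    rw [mem_closedBall_zero_iff] at hy
    rw [norm_pow, norm_pow, one_mul]
    exact pow_le_pow_of_le_one (norm_nonneg _) hy hk
  have hbl : Continuous fun y : ℝ => b (0, y) := hb.continuous.comp (by fun_prop)
  have hσ0 : σ 0 = 0 := by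
    have := eq_zero_of_pow_mul_isBigO (h := fun y => σ y - c * y ^ 2)
      (hσ.continuousAt.sub (by fun_prop)) 0 (by simpa using hO.trans (hpow 1 (by norm_num)))
    simpa using this
  have ha0 : a 0 = 0 := by
    have := eq_zero_of_pow_mul_isBigO (h := fun y => a 0 + y * (b (0, y) - c))
      (continuous_const.add (continuous_id.mul (hbl.sub continuous_const))).continuousAt 1
      ((hO.trans (hpow 2 (by norm_num))).congr' ?_ EventuallyEq.rfl)
    · simpa using this
    · filter_upwards [hexp] with y hy
      rw [hy, hσ0]; ring
  have hb0 : b 0 = c := by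
    have := eq_zero_of_pow_mul_isBigO (h := fun y => b (0, y) - c)
      (hbl.sub continuous_const).continuousAt 2
      (hO.congr' ?_ EventuallyEq.rfl)
    · exact sub_eq_zero.mp this
    · filter_upwards [hexp] with y hy
      rw [hy, hσ0, ha0]; ring
  refine ⟨fun y => b (0, y), hb.comp (contDiff_const.prodMk contDiff_id), hb0, ?_⟩
  filter_upwards [hexp] with y hy
  rw [hy, hσ0, ha0]; ring

/-- Used with `τ(0) = 1` to see that `∂s/∂y` can serve as a coordinate, and with `τ(0) = 0` to see
that `p'` and `p''` vanish at 0. -/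
theorem hasDerivAt_deriv_of_eq_sq_mul {σ τ : ℝ → ℝ} (hτ : ContDiff ℝ ∞ τ)
    (h : ∀ᶠ y in 𝓝 0, σ y = y ^ 2 * τ y) :
    deriv σ 0 = 0 ∧ HasDerivAt (deriv σ) (2 * τ 0) 0 := by
  have hd : ∀ᶠ y in 𝓝 0, deriv σ y = y * (2 * τ y + y * deriv τ y) := by
    filter_upwards [h.eventually_nhds] with y hy
    have := (hasDerivAt_pow 2 y).mul ((hτ.differentiable (by simp)) y).hasDerivAt
    rw [(this.congr_of_eventuallyEq hy).deriv]
    simp; ring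
  refine ⟨by simpa using hd.self_of_nhds, ?_⟩
  have hτ' : Differentiable ℝ (deriv τ) :=
    (contDiff_infty_iff_deriv.mp hτ).2.differentiable (by simp)
  have := (hasDerivAt_id (0 : ℝ)).mul ((((hτ.differentiable (by simp)) 0).hasDerivAt.const_mul 2).add
    ((hasDerivAt_id (0 : ℝ)).mul (hτ' 0).hasDerivAt))
  refine (this.congr_of_eventuallyEq hd).congr_deriv ?_
  simp

/-- The map `(x, y) ↦ (x, V(x, y))` has an inverse germ `(x, u) ↦ (x, Y(x, u))` if `∂V/∂y ≠ 0`. -/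
theorem SmoothGermAt.exists_fiber_inverse {V : ℝ × ℝ → ℝ} (hV : SmoothGermAt V 0) (hV0 : V 0 = 0)
    (hV1 : fderiv ℝ V 0 (0, 1) ≠ 0) :
    ∃ Y : ℝ × ℝ → ℝ, SmoothGermAt Y 0 ∧ Y 0 = 0 ∧ fderiv ℝ Y 0 (0, 1) ≠ 0 ∧
      (∀ᶠ z in 𝓝 0, Y (z.1, V z) = z.2) ∧ ∀ᶠ z in 𝓝 0, V (z.1, Y z) = z.2 := by
  have hD : IsDiffeoGerm (fun z : ℝ × ℝ => (z.1, V z)) 0 0 := by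
    refine .of_fderiv_injective (by simp [hV0]) ((contDiff_fst.smoothGermAt _).prodMk hV) ?_
    intro v hv
    rw [(hasFDerivAt_fst.prodMk hV.differentiableAt.hasFDerivAt).fderiv] at hv
    simp only [ContinuousLinearMap.prod_apply, ContinuousLinearMap.coe_fst', Prod.mk_eq_zero] at hv
    obtain ⟨h1, h2⟩ := hv
    have e : v = v.2 • ((0 : ℝ), (1 : ℝ)) := by ext <;> simp [h1]
    rw [e, map_smul, smul_eq_mul] at h2
    have : v.2 = 0 := by simpa [hV1] using h2
    ext <;> simp [h1, this]
  obtain ⟨H, hH, h1, h2⟩ := hD.exists_inverse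
  have hY : SmoothGermAt (fun z => (H z).2) 0 :=
    (contDiff_snd.smoothGermAt (H 0)).comp hH.2.1 rfl
  have hYV : ∀ᶠ z in 𝓝 0, (H (z.1, V z)).2 = z.2 := by
    filter_upwards [h1] with z hz using by rw [hz]
  refine ⟨fun z => (H z).2, hY, by simp [hH.1], ?_, hYV, ?_⟩
  -- The chain rule gives `∂Y/∂u · ∂V/∂y = 1` at 0.
  · intro h0
    have hYd : HasFDerivAt (fun z => (H z).2) (fderiv ℝ (fun z => (H z).2) 0)
        ((fun z : ℝ × ℝ => (z.1, V z)) 0) := by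
      simp only [hV0]; exact hY.differentiableAt.hasFDerivAt
    have hc := hYd.comp (0 : ℝ × ℝ) (hasFDerivAt_fst.prodMk hV.differentiableAt.hasFDerivAt)
    have := (hc.congr_of_eventuallyEq (f₁ := Prod.snd) (hYV.mono fun z hz => hz.symm)).unique
      hasFDerivAt_snd
    have := DFunLike.congr_fun this ((0 : ℝ), (1 : ℝ))
    simp only [ContinuousLinearMap.comp_apply, ContinuousLinearMap.prod_apply,
      ContinuousLinearMap.coe_fst', ContinuousLinearMap.coe_snd'] at this
    rw [show ((0 : ℝ), fderiv ℝ V 0 (0, 1)) = fderiv ℝ V 0 (0, 1) • ((0 : ℝ), (1 : ℝ)) by simp,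
      map_smul, h0] at this
    simp at this
  · filter_upwards [h2] with z hz
    have e1 := congrArg Prod.fst hz
    have e2 := congrArg Prod.snd hz
    simp only at e1 e2
    rw [← e1]; exact e2

theorem HasFDerivAt.hasDerivAt_comp_prodMk {f : ℝ × ℝ → ℝ} {f' : ℝ × ℝ →L[ℝ] ℝ} {x y : ℝ}
    (hf : HasFDerivAt f f' (x, y)) : HasDerivAt (fun t => f (x, t)) (f' (0, 1)) y :=
  hf.comp_hasDerivAt y ((hasDerivAt_const y x).prodMk (hasDerivAt_id y))

/-- Parametrized Morse lemma in one variable. -/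
theorem SmoothGermAt.exists_morse {s : ℝ × ℝ → ℝ} (hs : SmoothGermAt s 0)
    (hO : (fun y : ℝ => s (0, y) - 1 * y ^ 2) =O[𝓝 0] fun y => y ^ 3)
    (hs0 : s 0 = 0) :
    ∃ (m : ℝ → ℝ) (V : ℝ × ℝ → ℝ), SmoothGermAt m 0 ∧ m 0 = 0 ∧ SmoothGermAt V 0 ∧ V 0 = 0 ∧
      fderiv ℝ V 0 (0, 1) ≠ 0 ∧ ∀ᶠ z in 𝓝 0, s z = m z.1 + V z ^ 2 := by
  have hline : Tendsto (fun y : ℝ => ((0 : ℝ), y)) (𝓝 0) (𝓝 0) :=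
    (by fun_prop : Continuous fun y : ℝ => ((0 : ℝ), y)).tendsto' _ _ rfl
  have hσ : SmoothGermAt (fun y => s (0, y)) 0 :=
    SmoothGermAt.comp (y := (0 : ℝ × ℝ)) hs
      ((contDiff_const.prodMk contDiff_id).smoothGermAt (0 : ℝ)) rfl
  obtain ⟨τ, hτ, hτ0, hστ⟩ := hσ.exists_eq_sq_mul hO
  obtain ⟨hd0, hd1⟩ := hasDerivAt_deriv_of_eq_sq_mul hτ hστ
  set w : ℝ × ℝ → ℝ := fun z => fderiv ℝ s z (0, 1) with hw
  have hwσ : ∀ᶠ y in 𝓝 (0 : ℝ), deriv (fun y => s (0, y)) y = w (0, y) := by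
    filter_upwards [hline.eventually hs] with y hy
    exact (hy.differentiableAt (by simp)).hasFDerivAt.hasDerivAt_comp_prodMk.deriv
  have hws : SmoothGermAt w 0 := hs.fderiv_apply _
  have hw0 : w 0 = 0 := by rw [← hd0, hwσ.self_of_nhds]; rfl
  have hwline : HasDerivAt (fun y => w (0, y)) 2 0 := by
    refine (hd1.congr_of_eventuallyEq (hwσ.mono fun y hy => hy.symm)).congr_deriv ?_
    rw [hτ0]; norm_num
  have hw1 : fderiv ℝ w 0 (0, 1) = 2 :=
    HasDerivAt.unique (HasFDerivAt.hasDerivAt_comp_prodMk (x := 0) (y := 0)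
      hws.differentiableAt.hasFDerivAt) hwline
  -- The derivative `w = ∂s/∂y` replaces `y` as coordinate, which places the fibrewise critical
  -- points on `w = 0`.
  obtain ⟨Y, hY, hY0, -, hYw, hwY⟩ := hws.exists_fiber_inverse hw0 (by rw [hw1]; norm_num)
  set s₁ : ℝ × ℝ → ℝ := fun z => s (z.1, Y z) with hs₁
  have hs₁s : SmoothGermAt s₁ 0 :=
    hs.comp ((contDiff_fst.smoothGermAt _).prodMk hY) (by simp [hY0])
  obtain ⟨a, ha, hsa⟩ := hs₁s.exists_hadamard
  obtain ⟨b, hb, hab⟩ := (ha.smoothGermAt 0).exists_hadamard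
  have hproj : Tendsto (fun z : ℝ × ℝ => (z.1, (0 : ℝ))) (𝓝 0) (𝓝 0) :=
    (by fun_prop : Continuous fun z : ℝ × ℝ => (z.1, (0 : ℝ))).tendsto' _ _ rfl
  have hHtend : Tendsto (fun z : ℝ × ℝ => (z.1, Y z)) (𝓝 0) (𝓝 0) := by
    have := ((contDiff_fst (𝕜 := ℝ) (n := ∞)).smoothGermAt (0 : ℝ × ℝ)).prodMk hY |>.continuousAt
    rwa [ContinuousAt, hY0] at this
  -- Here `a(x, 0)` is the derivative of `s₁` across the critical curve, which vanishes, so a second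
  -- factor of the coordinate splits off.
  have ha0 : ∀ᶠ z in 𝓝 (0 : ℝ × ℝ), a (z.1, 0) = 0 := by
    filter_upwards [hproj.eventually hsa.eventually_nhds, hproj.eventually hwY, hproj.eventually hY,
      hproj.eventually (hHtend.eventually hs)] with ⟨x, u⟩ h1 h2 h3 h4
    simp only at h1 h2 h3 h4
    have d1 : HasDerivAt (fun t => s₁ (x, 0) + t * a (x, t)) (a (x, 0)) 0 := by
      have := ((hasDerivAt_id (0 : ℝ)).mul (HasFDerivAt.hasDerivAt_comp_prodMk (x := x) (y := 0)
        (ha.differentiable (by simp) _).hasFDerivAt)).const_add (s₁ (x, 0))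
      refine this.congr_deriv (by simp)
    have dY := (h3.differentiableAt (by simp)).hasFDerivAt.hasDerivAt_comp_prodMk
    have d2 : HasDerivAt (fun t => s₁ (x, t)) _ 0 :=
      (h4.differentiableAt (by simp)).hasFDerivAt.comp_hasDerivAt 0
        ((hasDerivAt_const (0 : ℝ) x).prodMk dY)
    have hl : Tendsto (fun t : ℝ => (x, t)) (𝓝 0) (𝓝 (x, 0)) :=
      (by fun_prop : Continuous fun t : ℝ => (x, t)).tendsto' _ _ rfl
    have d3 := (d2.congr_of_eventuallyEq ((hl.eventually h1).mono fun t ht => ht.symm)).unique d1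
    rw [← d3, show ((0 : ℝ), fderiv ℝ Y (x, 0) (0, 1)) =
      fderiv ℝ Y (x, 0) (0, 1) • ((0 : ℝ), (1 : ℝ)) by simp, map_smul]
    have : fderiv ℝ s (x, Y (x, 0)) (0, 1) = 0 := h2
    rw [this, smul_zero]
  have hs₁b : ∀ᶠ z in 𝓝 (0 : ℝ × ℝ), s₁ z = s₁ (z.1, 0) + z.2 ^ 2 * b z := by
    filter_upwards [hsa, hab, ha0] with z h1 h2 h3
    rw [h1, h2, h3]; ring
  have hDtend : Tendsto (fun z : ℝ × ℝ => (z.1, w z)) (𝓝 0) (𝓝 0) := by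
    have := ((contDiff_fst (𝕜 := ℝ) (n := ∞)).smoothGermAt (0 : ℝ × ℝ)).prodMk hws |>.continuousAt
    rwa [ContinuousAt, hw0] at this
  have hsb : ∀ᶠ z in 𝓝 (0 : ℝ × ℝ), s z = s₁ (z.1, 0) + w z ^ 2 * b (z.1, w z) := by
    filter_upwards [hDtend.eventually hs₁b, hYw] with z h1 h2
    rw [← h1]
    simp only [hs₁, h2]
  have hs₁0 : s₁ 0 = 0 := by
    simp only [hs₁, hY0]; exact hs0
  -- Along `x = 0`, dividing `s = w² b` by `y²` and letting `y → 0` gives `4 b(0) = 1`. Positivity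
  -- allows `V = w √b`.
  have hb0 : 0 < b 0 := by
    have hslope := hasDerivAt_iff_tendsto_slope_zero.mp hwline
    have hlim : Tendsto (fun y : ℝ => (y⁻¹ * w (0, y)) ^ 2 * b (0, w (0, y))) (𝓝[≠] 0)
        (𝓝 (2 ^ 2 * b 0)) := by
      have h1 : Tendsto (fun y : ℝ => y⁻¹ * w (0, y)) (𝓝[≠] 0) (𝓝 2) := by
        refine hslope.congr fun y => ?_
        have : w ((0 : ℝ), (0 : ℝ)) = 0 := hw0
        simp [this]
      exact (h1.pow 2).mul ((hb.continuous.tendsto 0).comp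
        ((hDtend.comp hline).mono_left nhdsWithin_le_nhds))
    have hlim' : Tendsto τ (𝓝[≠] 0) (𝓝 1) := by
      rw [← hτ0]; exact (hτ.continuous.tendsto 0).mono_left nhdsWithin_le_nhds
    have heq : (fun y : ℝ => (y⁻¹ * w (0, y)) ^ 2 * b (0, w (0, y))) =ᶠ[𝓝[≠] 0] τ := by
      filter_upwards [nhdsWithin_le_nhds (hline.eventually hsb), nhdsWithin_le_nhds hστ,
        self_mem_nhdsWithin] with y h1 h2 h3
      have h3' : y ≠ 0 := h3
      have : s₁ ((0 : ℝ), (0 : ℝ)) = 0 := hs₁0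
      simp only [h2, this, zero_add] at h1
      field_simp
      linarith
    have := tendsto_nhds_unique (hlim.congr' heq) hlim'
    linarith
  have hc : SmoothGermAt (fun z : ℝ × ℝ => √(b (z.1, w z))) 0 := by
    have hpos : ∀ᶠ z in 𝓝 (0 : ℝ × ℝ), 0 < b z := hb.continuous.continuousAt.eventually
      (lt_mem_nhds hb0)
    filter_upwards [hws, hDtend.eventually hpos] with z h1 h2
    exact (hb.contDiffAt.comp z (contDiffAt_fst.prodMk h1)).sqrt h2.ne'
  refine ⟨fun x => s₁ (x, 0), fun z => w z * √(b (z.1, w z)), ?_, hs₁0, hws.mul hc, by simp [hw0],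
    ?_, ?_⟩
  · exact SmoothGermAt.comp (y := (0 : ℝ × ℝ)) hs₁s
      ((contDiff_id.prodMk contDiff_const).smoothGermAt (0 : ℝ)) rfl
  · have := hws.differentiableAt.hasFDerivAt.mul hc.differentiableAt.hasFDerivAt
    have e := this.fderiv
    have hq : 0 < √(b 0) := Real.sqrt_pos.mpr hb0
    rw [show (fun z => w z * √(b (z.1, w z))) = w * (fun z => √(b (z.1, w z))) from rfl, e]
    simp only [smul_apply, hw0, hw1, zero_smul,
      smul_eq_mul, zero_add, Prod.fst_zero]
    have : b ((0 : ℝ), (0 : ℝ)) = b 0 := rfl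
    rw [this]
    positivity
  · have hpos : ∀ᶠ z in 𝓝 (0 : ℝ × ℝ), 0 < b z := hb.continuous.continuousAt.eventually
      (lt_mem_nhds hb0)
    filter_upwards [hsb, hDtend.eventually hpos] with z h1 h2
    rw [h1, mul_pow, Real.sq_sqrt h2.le]

/-! ### Reduction to the cross-cap normal form. -/

theorem smoothGermAt_euclidean {E : Type*} [NormedAddCommGroup E] [NormedSpace ℝ E] {f : E → E3}
    {x : E} (h : ∀ i, SmoothGermAt (fun z => f z i) x) : SmoothGermAt f x := by
  filter_upwards [eventually_all.mpr h] with z hz using contDiffAt_euclidean.mpr hz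

/-- In the coordinates `(x, u) = (x, V(x, y))` the function `x y + p(y)` has a fold decomposition
`A(x, u²) + u B(x, u²)` with `A(0) = B(0) = 0` and `∂B/∂x (0) ≠ 0`. -/
theorem exists_crossCap_decomposition {p : ℝ → ℝ} {V : ℝ × ℝ → ℝ} (hp : SmoothGermAt p 0)
    (hO : (fun y => p y - 0 * y ^ 2) =O[𝓝 0] fun y => y ^ 3) (hV : SmoothGermAt V 0)
    (hV0 : V 0 = 0) (hV1 : fderiv ℝ V 0 (0, 1) ≠ 0) :
    ∃ A B : ℝ × ℝ → ℝ, ContDiff ℝ ∞ A ∧ ContDiff ℝ ∞ B ∧ A 0 = 0 ∧ B 0 = 0 ∧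
      fderiv ℝ B 0 (1, 0) ≠ 0 ∧
      ∀ᶠ z in 𝓝 0, z.1 * z.2 + p z.2 = A (z.1, V z ^ 2) + V z * B (z.1, V z ^ 2) := by
  obtain ⟨τ, hτ, hτ0, hpτ⟩ := hp.exists_eq_sq_mul hO
  obtain ⟨hd0, hd1⟩ := hasDerivAt_deriv_of_eq_sq_mul hτ hpτ
  rw [hτ0, mul_zero] at hd1
  have hp0 : p 0 = 0 := by simpa using hpτ.self_of_nhds
  obtain ⟨Y, hY, hY0, hY1, hYV, hVY⟩ := hV.exists_fiber_inverse hV0 hV1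
  have hG : SmoothGermAt (fun z => z.1 * Y z + p (Y z)) 0 :=
    ((contDiff_fst.smoothGermAt _).mul hY).add (hp.comp hY hY0)
  obtain ⟨A, B, hA, hB, hAB⟩ := hG.exists_fold_decomposition
  have hx : Tendsto (fun x : ℝ => (x, (0 : ℝ))) (𝓝 0) (𝓝 0) :=
    (by fun_prop : Continuous fun x : ℝ => (x, (0 : ℝ))).tendsto' _ _ rfl
  have hYx : Tendsto (fun x : ℝ => Y (x, 0)) (𝓝 0) (𝓝 0) := by
    have := hY.continuousAt.tendsto.comp hx
    rwa [hY0] at this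
  -- Differentiating the decomposition in `u` at `u = 0` isolates `B(x, 0)`, since `u²` has zero
  -- derivative there.
  have hBx : ∀ᶠ x in 𝓝 (0 : ℝ), B (x, 0) = (x + deriv p (Y (x, 0))) * fderiv ℝ Y (x, 0) (0, 1) := by
    filter_upwards [hx.eventually hAB.eventually_nhds, hx.eventually hY, hYx.eventually hp]
      with x h1 h2 h3
    have dY := (h2.differentiableAt (by simp)).hasFDerivAt.hasDerivAt_comp_prodMk
    have dp : HasDerivAt (fun t => p (Y (x, t))) _ 0 :=
      (h3.differentiableAt (by simp)).hasDerivAt.comp (0 : ℝ) dY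
    have d1 := (dY.const_mul x).add dp
    have dsq : HasDerivAt (fun t : ℝ => (x, t ^ 2)) ((0 : ℝ), (0 : ℝ)) 0 :=
      (hasDerivAt_const (0 : ℝ) x).prodMk (by simpa using hasDerivAt_pow 2 (0 : ℝ))
    have hsq : (x, (0 : ℝ)) = (x, (0 : ℝ) ^ 2) := by simp
    have dA : HasDerivAt (fun t : ℝ => A (x, t ^ 2)) _ 0 :=
      ((hA.differentiable (by simp)) (x, 0 ^ 2)).hasFDerivAt.comp_hasDerivAt (0 : ℝ) dsq
    have dB : HasDerivAt (fun t : ℝ => B (x, t ^ 2)) _ 0 :=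
      ((hB.differentiable (by simp)) (x, 0 ^ 2)).hasFDerivAt.comp_hasDerivAt (0 : ℝ) dsq
    have d2 := dA.add ((hasDerivAt_id (0 : ℝ)).mul dB)
    have hl : Tendsto (fun t : ℝ => (x, t)) (𝓝 0) (𝓝 (x, 0)) :=
      (by fun_prop : Continuous fun t : ℝ => (x, t)).tendsto' _ _ rfl
    have := (d2.congr_of_eventuallyEq (hl.eventually h1)).unique d1
    rw [show ((0 : ℝ), (0 : ℝ)) = 0 from rfl] at this
    simp only [map_zero, id, mul_zero, add_zero, zero_add, one_mul] at this
    rw [hsq, this]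
    simp only [ne_eq, OfNat.ofNat_ne_zero, not_false_eq_true, zero_pow]
    ring
  refine ⟨A, B, hA, hB, ?_, ?_, ?_, ?_⟩
  · have := hAB.self_of_nhds
    simp only [Prod.fst_zero, Prod.snd_zero, hY0, hp0, zero_mul, add_zero] at this
    rw [zero_pow two_ne_zero] at this
    exact this.symm
  · have := hBx.self_of_nhds
    have h0 : Y ((0 : ℝ), (0 : ℝ)) = 0 := hY0
    rw [h0, hd0, add_zero, zero_mul] at this
    exact this
  · have hl : HasDerivAt (fun x : ℝ => (x, (0 : ℝ))) ((1 : ℝ), (0 : ℝ)) 0 :=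
      (hasDerivAt_id (0 : ℝ)).prodMk (hasDerivAt_const _ _)
    have hBd : HasDerivAt (fun x : ℝ => B (x, 0)) (fderiv ℝ B 0 (1, 0)) 0 :=
      HasFDerivAt.comp_hasDerivAt (f := fun x : ℝ => (x, (0 : ℝ))) (0 : ℝ)
        ((hB.differentiable (by simp)) (0 : ℝ × ℝ)).hasFDerivAt hl
    have hYd : HasDerivAt (fun x : ℝ => Y (x, 0)) (fderiv ℝ Y 0 (1, 0)) 0 :=
      HasFDerivAt.comp_hasDerivAt (f := fun x : ℝ => (x, (0 : ℝ))) (0 : ℝ)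
        (hY.differentiableAt).hasFDerivAt hl
    have hYud : HasDerivAt (fun x : ℝ => fderiv ℝ Y (x, 0) (0, 1)) _ 0 :=
      HasFDerivAt.comp_hasDerivAt (f := fun x : ℝ => (x, (0 : ℝ))) (0 : ℝ)
        ((hY.fderiv_apply (0, 1)).differentiableAt).hasFDerivAt hl
    have h0 : Y ((0 : ℝ), (0 : ℝ)) = 0 := hY0
    have hpd : HasDerivAt (fun x : ℝ => deriv p (Y (x, 0))) (0 * fderiv ℝ Y 0 (1, 0)) 0 :=
      HasDerivAt.comp (h₂ := deriv p) (0 : ℝ) (by rw [h0]; exact hd1) hYd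
    -- As `p'(0) = p''(0) = 0`, the product rule leaves `∂B/∂x(0) = ∂Y/∂u(0)`.
    have := ((((hasDerivAt_id (0 : ℝ)).add hpd).mul hYud).congr_of_eventuallyEq hBx).unique hBd
    rw [← this]
    simp only [Pi.add_apply, id, h0, hd0, zero_mul, add_zero, one_mul]
    exact hY1
  · have hDtend : Tendsto (fun z : ℝ × ℝ => (z.1, V z)) (𝓝 0) (𝓝 0) := by
      have := ((contDiff_fst (𝕜 := ℝ) (n := ∞)).smoothGermAt (0 : ℝ × ℝ)).prodMk hV |>.continuousAt
      rwa [ContinuousAt, hV0] at this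
    filter_upwards [hDtend.eventually hAB, hYV] with z h1 h2
    rw [h2] at h1
    exact h1

/-- A map germ `(x, y) ↦ (x, x y + p(y), s(x, y))` with `p(y) = O(y³)` and `s(0, y) = y² + O(y³)`
has a cross-cap singularity. -/
theorem hasCrossCapAt_of_expansion {p : ℝ → ℝ} {s : ℝ × ℝ → ℝ} (hp : SmoothGermAt p 0)
    (hpO : (fun y => p y - 0 * y ^ 2) =O[𝓝 0] fun y => y ^ 3) (hs : SmoothGermAt s 0)
    (hsO : (fun y : ℝ => s (0, y) - 1 * y ^ 2) =O[𝓝 0] fun y => y ^ 3) (hs0 : s 0 = 0)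
    (hp0 : p 0 = 0) :
    HasCrossCapAt (fun z => !₂[z.1, z.1 * z.2 + p z.2, s z]) 0 := by
  obtain ⟨m, V, hm, hm0, hV, hV0, hV1, hsV⟩ := hs.exists_morse hsO hs0
  obtain ⟨A, B, hA, hB, hA0, hB0, hB1, hAB⟩ := exists_crossCap_decomposition hp hpO hV hV0 hV1
  have hB1' : ∀ t : ℝ, fderiv ℝ B 0 (t, 0) = 0 → t = 0 := by
    intro t ht
    rw [show (t, (0 : ℝ)) = t • ((1 : ℝ), (0 : ℝ)) by simp, map_smul, smul_eq_mul] at ht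
    simpa [hB1] using ht
  have hV1' : ∀ t : ℝ, fderiv ℝ V 0 (0, t) = 0 → t = 0 := by
    intro t ht
    rw [show ((0 : ℝ), t) = t • ((0 : ℝ), (1 : ℝ)) by simp, map_smul, smul_eq_mul] at ht
    simpa [hV1] using ht
  have hf : SmoothGermAt (fun z : ℝ × ℝ => (!₂[z.1, z.1 * z.2 + p z.2, s z] : E3)) 0 := by
    refine smoothGermAt_euclidean fun i => ?_
    fin_cases i
    · exact contDiff_fst.smoothGermAt _
    · exact ((contDiff_fst.mul contDiff_snd).smoothGermAt _).add
        (SmoothGermAt.comp (y := (0 : ℝ)) hp (contDiff_snd.smoothGermAt _) rfl)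
    · exact hs
  -- the change of coordinates in the source
  have hsV2 : SmoothGermAt (fun z : ℝ × ℝ => (z.1, V z ^ 2)) 0 :=
    (contDiff_fst.smoothGermAt _).prodMk
      (((hV.mul hV)).congr (Eventually.of_forall fun z => (pow_two _).symm))
  have hh : IsDiffeoGerm (fun z : ℝ × ℝ => (B (z.1, V z ^ 2), V z)) 0 0 := by
    have hdV := hV.differentiableAt.hasFDerivAt
    have hdB : HasFDerivAt B (fderiv ℝ B 0) ((fun z : ℝ × ℝ => (z.1, V z ^ 2)) 0) := by
      simp only [hV0]
      rw [show ((0 : ℝ × ℝ).1, (0 : ℝ) ^ 2) = 0 by simp]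
      exact (hB.differentiable (by simp) 0).hasFDerivAt
    -- Since `V(0) = 0`, the term `V²` drops out and the first component has differential `∂B/∂x(0)
    -- dx`.
    have hd := (hdB.comp (0 : ℝ × ℝ) (hasFDerivAt_fst.prodMk (hdV.pow 2))).prodMk hdV
    refine .of_fderiv_injective (Prod.ext ?_ hV0) ?_ fun v hv => ?_
    · show B (0, V 0 ^ 2) = 0
      rw [hV0, zero_pow two_ne_zero]; exact hB0
    · exact ((hB.smoothGermAt _).comp hsV2 rfl).prodMk hV
    · rw [show (fun z : ℝ × ℝ => (B (z.1, V z ^ 2), V z)) = fun z =>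
        ((B ∘ fun z : ℝ × ℝ => (z.1, V z ^ 2)) z, V z) from rfl, hd.fderiv] at hv
      simp only [ContinuousLinearMap.prod_apply, ContinuousLinearMap.comp_apply, hV0,
        Prod.mk_eq_zero] at hv
      obtain ⟨h1, h2⟩ := hv
      have h1' : v.1 = 0 := hB1' _ (by simpa using h1)
      have h2' : v.2 = 0 := hV1' _ (by rwa [show ((0 : ℝ), v.2) = v from Prod.ext h1'.symm rfl])
      exact Prod.ext h1' h2'
  -- the change of coordinates in the target
  let pr : Fin 3 → E3 →L[ℝ] ℝ := fun i => EuclideanSpace.proj i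
  have hc : ∀ i, SmoothGermAt (fun X : E3 => X i) 0 := fun i => (pr i).contDiff.smoothGermAt 0
  have hdc : ∀ i, HasFDerivAt (fun X : E3 => X i) (pr i) 0 := fun i => (pr i).hasFDerivAt
  have hκ : SmoothGermAt (fun X : E3 => X 2 + -1 * m (X 0)) 0 :=
    (hc 2).add ((contDiff_const.smoothGermAt _).mul (hm.comp (hc 0) rfl))
  have hκ' : SmoothGermAt (fun X : E3 => (X 0, X 2 + -1 * m (X 0))) 0 := (hc 0).prodMk hκ
  have hk : IsDiffeoGerm (fun X : E3 => (!₂[B (X 0, X 2 + -1 * m (X 0)),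
      X 1 + -1 * A (X 0, X 2 + -1 * m (X 0)), X 2 + -1 * m (X 0)] : E3)) 0 0 := by
    have hks : SmoothGermAt (fun X : E3 => (!₂[B (X 0, X 2 + -1 * m (X 0)),
      X 1 + -1 * A (X 0, X 2 + -1 * m (X 0)), X 2 + -1 * m (X 0)] : E3)) 0 := by
      refine smoothGermAt_euclidean fun i => ?_
      fin_cases i
      · exact (hB.smoothGermAt _).comp hκ' rfl
      · exact (hc 1).add ((contDiff_const.smoothGermAt _).mul ((hA.smoothGermAt _).comp hκ' rfl))
      · exact hκ
    have hz : ((0 : E3) 0, (0 : E3) 2 + -1 * m ((0 : E3) 0)) = (0 : ℝ × ℝ) := by simp [hm0]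
    refine .of_fderiv_injective ?_ hks fun v hv => ?_
    · simp only [hz, hB0, hA0]
      ext i; fin_cases i <;> simp [hm0]
    · have hcomp : ∀ i : Fin 3, HasFDerivAt (fun X : E3 => (!₂[B (X 0, X 2 + -1 * m (X 0)),
          X 1 + -1 * A (X 0, X 2 + -1 * m (X 0)), X 2 + -1 * m (X 0)] : E3) i)
          ((pr i).comp (fderiv ℝ _ 0)) 0 := fun i =>
        (pr i).hasFDerivAt.comp (0 : E3) hks.differentiableAt.hasFDerivAt
      have hcv : ∀ i : Fin 3, (pr i).comp (fderiv ℝ (fun X : E3 => (!₂[B (X 0, X 2 + -1 * m (X 0)),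
          X 1 + -1 * A (X 0, X 2 + -1 * m (X 0)), X 2 + -1 * m (X 0)] : E3)) 0) v = 0 := by
        intro i
        rw [ContinuousLinearMap.comp_apply, hv, map_zero]
      have hdm : HasFDerivAt (fun X : E3 => m (X 0)) (deriv m 0 • pr 0) 0 :=
        HasDerivAt.comp_hasFDerivAt (f := fun X : E3 => X 0) (0 : E3)
          hm.differentiableAt.hasDerivAt (hdc 0)
      have d2 : HasFDerivAt (fun X : E3 => X 2 + -1 * m (X 0)) _ 0 :=
        (hdc 2).add (hdm.const_mul (-1))
      have hpair := (hdc 0).prodMk d2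
      have dB : HasFDerivAt (fun X : E3 => B (X 0, X 2 + -1 * m (X 0))) _ 0 :=
        HasFDerivAt.comp (g := B) (g' := fderiv ℝ B 0) (0 : E3)
          (by rw [hz]; exact (hB.differentiable (by simp) 0).hasFDerivAt) hpair
      have dA : HasFDerivAt (fun X : E3 => A (X 0, X 2 + -1 * m (X 0))) _ 0 :=
        HasFDerivAt.comp (g := A) (g' := fderiv ℝ A 0) (0 : E3)
          (by rw [hz]; exact (hA.differentiable (by simp) 0).hasFDerivAt) hpair
      have d1 := (hdc 1).add (dA.const_mul (-1))
      have e2 := DFunLike.congr_fun ((hcomp 2).unique d2) v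
      have e0 := DFunLike.congr_fun ((hcomp 0).unique dB) v
      have e1 := DFunLike.congr_fun ((hcomp 1).unique d1) v
      rw [hcv] at e0 e1 e2
      -- The third component gives `v₂ - m'(0) v₀ = 0`, the second argument of `dA` and `dB`. The
      -- system becomes triangular: `∂B/∂x(0) ≠ 0` yields `v₀ = 0`, then `v₁` and `v₂` vanish.
      rw [ContinuousLinearMap.comp_apply, ContinuousLinearMap.prod_apply, ← e2] at e0
      rw [add_apply, smul_apply, ContinuousLinearMap.comp_apply,
        ContinuousLinearMap.prod_apply, ← e2] at e1
      have v0 : v 0 = 0 := hB1' _ e0.symm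
      have v0' : pr 0 v = 0 := v0
      have v1 : v 1 = 0 := by
        rw [v0', show ((0 : ℝ), (0 : ℝ)) = 0 from rfl, map_zero] at e1
        simpa [pr] using e1.symm
      have v2 : v 2 = 0 := by
        simpa [v0', pr, v0] using e2.symm
      ext i; fin_cases i
      · exact v0
      · exact v1
      · exact v2
  refine AEquivalent.symm (f := fun z : ℝ × ℝ => (!₂[z.1, z.1 * z.2 + p z.2, s z] : E3))
    ⟨_, fun X => !₂[B (X 0, X 2 + -1 * m (X 0)), X 1 + -1 * A (X 0, X 2 + -1 * m (X 0)),
      X 2 + -1 * m (X 0)], hh, ?_, ?_⟩ hf.continuousAt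
  · convert! hk using 1
    · ext i; fin_cases i <;> simp [hp0, hs0]
    · ext i; fin_cases i <;> simp [crossCapModel]
  · filter_upwards [hsV, hAB] with z h1 h2
    ext i; fin_cases i
    · simp [crossCapModel, h1]
    · simp [crossCapModel, h1, h2]; ring
    · simp [crossCapModel, h1]

/-! ### First-order data and cross-cap type of the parametrization. -/

namespace GeometricCrossCap

variable (C : GeometricCrossCap)

theorem isBigO_p : (fun y => C.p y - 0 * y ^ 2) =O[𝓝 0] fun y => y ^ 3 := by
  obtain ⟨p₃, p₄, h⟩ := C.expansion_p
  have h4 : (fun y : ℝ => p₄ * y + y ^ 2) =O[𝓝 0] fun _ => (1 : ℝ) :=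
    (by fun_prop : ContinuousAt (fun y : ℝ => p₄ * y + y ^ 2) 0).isBigO_one ℝ
  have hpow : ∀ c : ℝ → ℝ, ContinuousAt c 0 → (fun y : ℝ => c y * y ^ 3) =O[𝓝 0] fun y => y ^ 3 := by
    intro c hc
    simpa using (hc.isBigO_one ℝ).mul (isBigO_refl (fun y : ℝ => y ^ 3) (𝓝 0))
  have h5 : (fun y : ℝ => y ^ 5) =O[𝓝 0] fun y => y ^ 3 :=
    (hpow (fun y => y ^ 2) (by fun_prop)).congr_left fun y => by ring
  exact ((h.trans h5).add (hpow (fun y => p₃ + p₄ * y) (by fun_prop))).congr_left fun y => by ring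

theorem isBigO_q : C.q =O[𝓝 0] fun z => ‖z‖ ^ 3 := by
  obtain ⟨q₃, q₄, h⟩ := C.expansion_q
  have hpow : ∀ k, (fun z : ℝ × ℝ => ‖z‖ ^ (3 + k)) =O[𝓝 0] fun z => ‖z‖ ^ 3 := by
    intro k
    have hc : ContinuousAt (fun z : ℝ × ℝ => ‖z‖ ^ k) 0 := by fun_prop
    exact ((isBigO_refl (fun z : ℝ × ℝ => ‖z‖ ^ 3) (𝓝 0)).mul (hc.isBigO_one ℝ)).congr
      (fun z => by ring) fun z => by ring
  have hmon : ∀ (c : ℝ) (i j : ℕ), (fun z : ℝ × ℝ => c * z.1 ^ i * z.2 ^ j) =O[𝓝 0]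
      fun z => ‖z‖ ^ (i + j) := by
    intro c i j
    have h1 : (fun z : ℝ × ℝ => z.1) =O[𝓝 0] fun z => ‖z‖ :=
      IsBigO.of_bound 1 (Eventually.of_forall fun z => by simpa using norm_fst_le z)
    have h2 : (fun z : ℝ × ℝ => z.2) =O[𝓝 0] fun z => ‖z‖ :=
      IsBigO.of_bound 1 (Eventually.of_forall fun z => by simpa using norm_snd_le z)
    exact (((h1.pow i).mul (h2.pow j)).const_mul_left c).congr (fun z => by ring)
      fun z => by ring
  have hs3 : (fun z : ℝ × ℝ => ∑ k ∈ Finset.range 4, q₃ k * z.1 ^ (3 - k) * z.2 ^ k) =O[𝓝 0]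
      fun z => ‖z‖ ^ 3 := by
    refine IsBigO.fun_sum fun k hk => ?_
    have := hmon (q₃ k) (3 - k) k
    rwa [Nat.sub_add_cancel (by have := Finset.mem_range.mp hk; omega)] at this
  have hs4 : (fun z : ℝ × ℝ => ∑ k ∈ Finset.range 5, q₄ k * z.1 ^ (4 - k) * z.2 ^ k) =O[𝓝 0]
      fun z => ‖z‖ ^ 3 := by
    refine IsBigO.fun_sum fun k hk => ?_
    have := hmon (q₄ k) (4 - k) k
    rw [Nat.sub_add_cancel (by have := Finset.mem_range.mp hk; omega)] at this
    exact this.trans (hpow 1)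
  exact ((h.trans (hpow 2)).add (hs3.add hs4)).congr_left fun z => by ring

theorem p_zero : C.p 0 = 0 := by
  obtain ⟨τ, -, -, h⟩ := C.smooth_p.exists_eq_sq_mul C.isBigO_p
  simpa using h.self_of_nhds

theorem hasDerivAt_p : HasDerivAt C.p 0 0 := by
  obtain ⟨τ, hτ, -, h⟩ := C.smooth_p.exists_eq_sq_mul C.isBigO_p
  have := C.smooth_p.differentiableAt.hasDerivAt
  rwa [(hasDerivAt_deriv_of_eq_sq_mul hτ h).1] at this

theorem q_zero : C.q 0 = 0 := by
  obtain ⟨c, hc⟩ := C.isBigO_q.bound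
  simpa using hc.self_of_nhds

theorem hasFDerivAt_q : HasFDerivAt C.q (0 : ℝ × ℝ →L[ℝ] ℝ) 0 := by
  rw [hasFDerivAt_iff_isLittleO_nhds_zero]
  have h1 : (fun z : ℝ × ℝ => ‖z‖ ^ 3) =o[𝓝 0] fun z => ‖z‖ ^ 1 :=
    (isLittleO_pow_pow (by norm_num : 1 < 3)).comp_tendsto
      (tendsto_norm_zero : Tendsto (fun z : ℝ × ℝ => ‖z‖) (𝓝 0) (𝓝 0))
  have h2 : (fun z : ℝ × ℝ => ‖z‖ ^ 1) =O[𝓝 0] fun z => z :=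
    IsBigO.of_bound 1 (Eventually.of_forall fun z => by simp)
  simpa [C.q_zero] using (C.isBigO_q.trans_isLittleO h1).trans_isBigO h2

theorem param_zero : C.param 0 = 0 := by
  ext i; fin_cases i <;> simp [param, C.p_zero, C.q_zero]

theorem smoothGermAt_height :
    SmoothGermAt (fun z : ℝ × ℝ => C.a * z.1 ^ 2 + C.b * z.1 * z.2 + z.2 ^ 2 + C.q z) 0 :=
  ((by fun_prop : ContDiff ℝ ∞ fun z : ℝ × ℝ =>
    C.a * z.1 ^ 2 + C.b * z.1 * z.2 + z.2 ^ 2).smoothGermAt 0).add C.smooth_q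

theorem hasCrossCapAt_param : HasCrossCapAt C.param 0 := by
  refine hasCrossCapAt_of_expansion C.smooth_p C.isBigO_p C.smoothGermAt_height ?_ ?_ C.p_zero
  · have hline : Tendsto (fun y : ℝ => ((0 : ℝ), y)) (𝓝 0) (𝓝 0) :=
      (by fun_prop : Continuous fun y : ℝ => ((0 : ℝ), y)).tendsto' _ _ rfl
    have := C.isBigO_q.comp_tendsto hline
    refine (this.trans (IsBigO.of_bound 1 (Eventually.of_forall fun y => ?_))).congr_left fun y => ?_
    · simp [Prod.norm_def]
    · simp
  · simp [C.q_zero]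

theorem hasFDerivAt_param : HasFDerivAt C.param
    ((ContinuousLinearMap.fst ℝ ℝ ℝ).smulRight (!₂[1, 0, 0] : E3)) 0 := by
  rw [← hasFDerivWithinAt_univ, hasFDerivWithinAt_euclidean]
  simp only [hasFDerivWithinAt_univ]
  have h1 := hasFDerivAt_fst (𝕜 := ℝ) (p := (0 : ℝ × ℝ)) (E := ℝ) (F := ℝ)
  have h2 := hasFDerivAt_snd (𝕜 := ℝ) (p := (0 : ℝ × ℝ)) (E := ℝ) (F := ℝ)
  intro i
  fin_cases i
  · refine h1.congr_fderiv ?_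
    ext <;> simp
  · have hp : HasFDerivAt (fun z : ℝ × ℝ => C.p z.2) _ 0 :=
      HasDerivAt.comp_hasFDerivAt (f := Prod.snd) (0 : ℝ × ℝ) C.hasDerivAt_p h2
    refine ((h1.mul h2).add hp).congr_fderiv ?_
    ext <;> simp
  · refine (((((h1.pow 2).const_mul C.a).add ((h1.const_mul C.b).mul h2)).add (h2.pow 2)).add
      C.hasFDerivAt_q).congr_fderiv ?_
    ext <;> simp

end GeometricCrossCap

/-! ### The folding map near the origin. -/

section Folding

variable (η : Metric.sphere (0 : E3) 1) (δ : ℝ)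

theorem inner_self_of_mem_sphere : inner ℝ (η : E3) (η : E3) = 1 := by
  rw [real_inner_self_eq_norm_sq, norm_eq_of_mem_sphere]; norm_num

theorem contDiff_foldingMap : ContDiff ℝ ∞ (foldingMap η δ) := by
  have h : ContDiff ℝ ∞ fun p : E3 => inner ℝ (η : E3) p := (innerSL ℝ (η : E3)).contDiff
  exact contDiff_id.add (((h.sub contDiff_const).mul
    ((h.sub contDiff_const).sub contDiff_const)).smul contDiff_const)

theorem hasFDerivAt_foldingMap_zero : HasFDerivAt (foldingMap η δ)
    (ContinuousLinearMap.id ℝ E3 - (1 + 2 * δ) • (innerSL ℝ (η : E3)).smulRight (η : E3)) 0 := by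
  have h : HasFDerivAt (fun p : E3 => inner ℝ (η : E3) p) (innerSL ℝ (η : E3)) 0 :=
    (innerSL ℝ (η : E3)).hasFDerivAt
  refine ((hasFDerivAt_id (0 : E3)).add (((h.sub_const δ).mul
    ((h.sub_const δ).sub_const 1)).smul_const (η : E3))).congr_fderiv ?_
  ext v i
  simp
  ring

theorem isDiffeoGerm_foldingMap (hδ : δ ≠ 0) :
    IsDiffeoGerm (foldingMap η δ) 0 (foldingMap η δ 0) := by
  refine .of_fderiv_injective rfl ((contDiff_foldingMap η δ).smoothGermAt 0) fun v hv => ?_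
  rw [(hasFDerivAt_foldingMap_zero η δ).fderiv] at hv
  have hv' : v = ((1 + 2 * δ) * inner ℝ (η : E3) v) • (η : E3) := by
    have := sub_eq_zero.mp hv
    simpa [mul_smul] using this
  -- Pairing the kernel equation with `η` leaves `2δ ⟨η, v⟩ = 0`.
  have h2 : inner ℝ (η : E3) v = (1 + 2 * δ) * inner ℝ (η : E3) v := by
    conv_lhs => rw [hv', inner_smul_right, inner_self_of_mem_sphere, mul_one]
  have h3 : inner ℝ (η : E3) v = 0 := by
    have : 2 * δ * inner ℝ (η : E3) v = 0 := by linarith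
    simpa [hδ] using this
  rw [hv', h3]; simp

/-- For a plane through the origin, folding replaces the signed distance `t` by `t + t(t - 1) = t²`;
this square is the source of the degeneracy. -/
theorem inner_foldingMap_zero (X : E3) :
    inner ℝ (η : E3) (foldingMap η 0 X) = inner ℝ (η : E3) X ^ 2 := by
  rw [foldingMap, inner_add_right, inner_smul_right, inner_self_of_mem_sphere]
  ring

end Folding

/-! ### The obstruction for planes through the origin. -/

/-- The two points are both at distance `O(s)` from 0 but differ by `s² w`. Strict differentiability
makes the error `o(s²)`, where plain differentiability at 0 would give only `o(s)`. -/
theorem HasStrictFDerivAt.tendsto_sq_quotient {E : Type*} [NormedAddCommGroup E] [NormedSpace ℝ E]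
    {L : E → ℝ} {L' : E →L[ℝ] ℝ} (hL : HasStrictFDerivAt L L' 0) (e w : E) :
    Tendsto (fun s : ℝ => (s ^ 2)⁻¹ * (L (s • e + s ^ 2 • w) - L (s • e))) (𝓝[≠] 0)
      (𝓝 (L' w)) := by
  have ht : Tendsto (fun s : ℝ => (s • e + s ^ 2 • w, s • e)) (𝓝[≠] 0) (𝓝 ((0 : E), (0 : E))) :=
    ((by fun_prop : Continuous fun s : ℝ => (s • e + s ^ 2 • w, s • e)).tendsto' 0 _
      (by simp)).mono_left nhdsWithin_le_nhds
  have ho := hL.isLittleO.comp_tendsto ht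
  have ho' : (fun s : ℝ => L (s • e + s ^ 2 • w) - L (s • e) - s ^ 2 * L' w) =o[𝓝[≠] 0]
      fun s : ℝ => s ^ 2 := by
    refine (ho.congr_left fun s => by simp).trans_isBigO ?_
    refine IsBigO.of_bound ‖w‖ (Eventually.of_forall fun s => ?_)
    simp [norm_smul, mul_comm]
  have h0 := (ho'.tendsto_div_nhds_zero).add_const (L' w)
  rw [zero_add] at h0
  refine h0.congr' ?_
  filter_upwards [self_mem_nhdsWithin] with s hs
  have hs' : s ≠ 0 := hs
  field_simp
  ring

theorem HasFDerivAt.tendsto_inv_mul {E : Type*} [NormedAddCommGroup E] [NormedSpace ℝ E]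
    {T : E → ℝ} {T' : E →L[ℝ] ℝ} (hT : HasFDerivAt T T' 0) (hT0 : T 0 = 0) (v : E) :
    Tendsto (fun s : ℝ => s⁻¹ * T (s • v)) (𝓝[≠] 0) (𝓝 (T' v)) := by
  have := (hT.hasLineDerivAt v).tendsto_slope_zero
  simpa [hT0] using this

/-- A function germ on `ℝ³` whose restriction to the standard cross-cap is the square of a function
`T` with `T(0) = 0` and `∂T/∂y (0) = 0` is not a submersion. -/
theorem fderiv_eq_zero_of_comp_crossCapModel_eq_sq {L : E3 → ℝ} {L' : E3 →L[ℝ] ℝ}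
    (hL : HasStrictFDerivAt L L' 0) {T : ℝ × ℝ → ℝ} {T' : ℝ × ℝ →L[ℝ] ℝ} (hT : HasFDerivAt T T' 0)
    (hT0 : T 0 = 0) (hT' : T' (0, 1) = 0) (h : ∀ᶠ z in 𝓝 0, L (crossCapModel z) = T z ^ 2) :
    L' = 0 := by
  let e₀ : E3 := !₂[1, 0, 0]
  let e₁ : E3 := !₂[0, 1, 0]
  let e₂ : E3 := !₂[0, 0, 1]
  have hT11 : T' (1, 1) = T' (1, 0) := by
    rw [show ((1 : ℝ), (1 : ℝ)) = (1, 0) + (0, 1) by simp, map_add, hT', add_zero]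
  have hcurve : ∀ v : ℝ × ℝ, ∀ᶠ s in 𝓝[≠] (0 : ℝ),
      L (crossCapModel (s • v)) = T (s • v) ^ 2 := by
    intro v
    have : Tendsto (fun s : ℝ => s • v) (𝓝 0) (𝓝 0) :=
      (by fun_prop : Continuous fun s : ℝ => s • v).tendsto' _ _ (zero_smul _ _)
    exact nhdsWithin_le_nhds (this.eventually h)
  -- Curves in the model whose differences isolate `e₂` and `e₁ + e₂` at order `s²`. As `T` has
  -- equal first-order terms along `(1, 1)` and `(1, 0)`, the corresponding differences of `T²` are
  -- `o(s²)`.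
  have c10 : ∀ s : ℝ, crossCapModel (s • ((1 : ℝ), (0 : ℝ))) = s • e₀ := by
    intro s; ext i; fin_cases i <;> simp [crossCapModel, e₀]
  have c11 : ∀ s : ℝ, crossCapModel (s • ((1 : ℝ), (1 : ℝ))) = s • e₀ + s ^ 2 • (e₁ + e₂) := by
    intro s; ext i; fin_cases i <;> simp [crossCapModel, e₀, e₁, e₂, pow_two]
  have c01 : ∀ s : ℝ, crossCapModel (s • ((0 : ℝ), (1 : ℝ))) = s • (0 : E3) + s ^ 2 • e₂ := by
    intro s; ext i; fin_cases i <;> simp [crossCapModel, e₂]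
  have hL0 : L 0 = 0 := by
    have := h.self_of_nhds
    rw [hT0, show crossCapModel 0 = 0 by ext i; fin_cases i <;> simp [crossCapModel]] at this
    simpa using this
  have h2 : L' e₂ = 0 := by
    have hlim := ((hT.tendsto_inv_mul hT0 (0, 1)).pow 2)
    rw [hT', zero_pow two_ne_zero] at hlim
    refine tendsto_nhds_unique (hL.tendsto_sq_quotient 0 e₂) (hlim.congr' ?_)
    filter_upwards [hcurve (0, 1)] with s hs
    rw [← c01, hs, smul_zero, hL0]
    ring
  have h1 : L' (e₁ + e₂) = 0 := by
    have hlim := ((hT.tendsto_inv_mul hT0 (1, 1)).pow 2).sub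
      ((hT.tendsto_inv_mul hT0 (1, 0)).pow 2)
    rw [hT11, sub_self] at hlim
    refine tendsto_nhds_unique (hL.tendsto_sq_quotient e₀ (e₁ + e₂)) (hlim.congr' ?_)
    filter_upwards [hcurve (1, 1), hcurve (1, 0)] with s hs hs'
    rw [← c11, ← c10, hs, hs']
    ring
  have h0 : L' e₀ = 0 := by
    have hlim := ((hT.tendsto_inv_mul hT0 (1, 0)).pow 2).mul
      (tendsto_id.mono_left (nhdsWithin_le_nhds (s := {(0 : ℝ)}ᶜ)))
    rw [mul_zero] at hlim
    refine tendsto_nhds_unique (hL.hasFDerivAt.tendsto_inv_mul hL0 e₀) (hlim.congr' ?_)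
    filter_upwards [hcurve (1, 0), self_mem_nhdsWithin] with s hs hs0
    have hs0' : s ≠ 0 := hs0
    rw [← c10, hs, id]
    field_simp
  rw [map_add, h2, add_zero] at h1
  ext v
  have : v = v 0 • e₀ + v 1 • e₁ + v 2 • e₂ := by
    ext i; fin_cases i <;> simp [e₀, e₁, e₂]
  rw [this]
  simp [h0, h1, h2]

theorem hasFDerivAt_crossCapModel_zero : HasFDerivAt crossCapModel
    ((ContinuousLinearMap.fst ℝ ℝ ℝ).smulRight (!₂[1, 0, 0] : E3)) 0 := by
  rw [← hasFDerivWithinAt_univ, hasFDerivWithinAt_euclidean]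
  simp only [hasFDerivWithinAt_univ]
  have h1 := hasFDerivAt_fst (𝕜 := ℝ) (p := (0 : ℝ × ℝ)) (E := ℝ) (F := ℝ)
  have h2 := hasFDerivAt_snd (𝕜 := ℝ) (p := (0 : ℝ × ℝ)) (E := ℝ) (F := ℝ)
  intro i
  fin_cases i
  · refine h1.congr_fderiv ?_
    ext <;> simp
  · refine (h1.mul h2).congr_fderiv ?_
    ext <;> simp
  · refine (h2.pow 2).congr_fderiv ?_
    ext <;> simp

/-! ### Singularity of the folded cross-cap and the two cases of `δ`. -/

namespace GeometricCrossCap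

variable (C : GeometricCrossCap) (η : Metric.sphere (0 : E3) 1) (δ : ℝ)

theorem hasFDerivAt_folding_zero : HasFDerivAt (C.folding η δ)
    ((fderiv ℝ (foldingMap η δ) 0).comp
      ((ContinuousLinearMap.fst ℝ ℝ ℝ).smulRight (!₂[1, 0, 0] : E3))) 0 := by
  have h : HasFDerivAt (foldingMap η δ) (fderiv ℝ (foldingMap η δ) 0) (C.param 0) := by
    rw [C.param_zero]
    exact ((contDiff_foldingMap η δ).smoothGermAt 0).differentiableAt.hasFDerivAt
  exact h.comp (0 : ℝ × ℝ) C.hasFDerivAt_param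

theorem isSingularAt_folding : IsSingularAt (C.folding η δ) 0 := by
  refine ⟨_, C.hasFDerivAt_folding_zero η δ, fun hinj => ?_⟩
  have := @hinj (0, 1) 0 (by simp)
  simp at this

theorem hasCrossCapAt_folding (hδ : δ ≠ 0) : HasCrossCapAt (C.folding η δ) 0 := by
  refine AEquivalent.trans C.hasCrossCapAt_param
    (IsDiffeoGerm.aequivalent_target (k := foldingMap η δ) (y := foldingMap η δ 0) ?_)
  rw [C.param_zero]
  exact isDiffeoGerm_foldingMap η δ hδ

theorem not_hasCrossCapAt_folding_zero : ¬ HasCrossCapAt (C.folding η 0) 0 := by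
  rintro ⟨h, k, hh, hk, H⟩
  have hcc : crossCapModel 0 = 0 := by ext i; fin_cases i <;> simp [crossCapModel]
  rw [hcc] at hk
  have dk := hk.2.1.differentiableAt.hasFDerivAt
  have dh := hh.2.1.differentiableAt.hasFDerivAt
  set P := (ContinuousLinearMap.fst ℝ ℝ ℝ).smulRight (!₂[1, 0, 0] : E3)
  have dl : HasFDerivAt (fun z => k (crossCapModel z)) ((fderiv ℝ k 0).comp P) 0 :=
    HasFDerivAt.comp (g := k) (0 : ℝ × ℝ) (by rw [hcc]; exact dk) hasFDerivAt_crossCapModel_zero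
  have dr : HasFDerivAt (fun z => C.folding η 0 (h z))
      (((fderiv ℝ (foldingMap η 0) 0).comp P).comp (fderiv ℝ h 0)) 0 :=
    HasFDerivAt.comp (g := C.folding η 0) (0 : ℝ × ℝ)
      (by rw [hh.1]; exact C.hasFDerivAt_folding_zero η 0) dh
  have hd := DFunLike.congr_fun ((dr.congr_of_eventuallyEq H).unique dl)
  simp only [ContinuousLinearMap.comp_apply, P, ContinuousLinearMap.smulRight_apply,
    ContinuousLinearMap.coe_fst', map_smul] at hd
  have he : (!₂[1, 0, 0] : E3) ≠ 0 := fun h0 => by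
    simpa using congrArg (fun v : E3 => v 0) h0
  -- Otherwise the folding differential would kill `e₀`, and the chain rule identity `hd` at `(1,
  -- 0)` would make `dk` kill it as well.
  have hker : (fderiv ℝ h 0 (0, 1)).1 = 0 := by
    have h1 := hd (0, 1)
    rw [zero_smul, smul_eq_zero] at h1
    refine h1.resolve_right fun h2 => he (hk.fderiv_injective ?_)
    have h3 := hd (1, 0)
    rw [h2, smul_zero, one_smul] at h3
    rw [← h3, map_zero]
  let T : ℝ × ℝ → ℝ := fun z => inner ℝ (η : E3) (C.param (h z))
  have dT : HasFDerivAt T ((innerSL ℝ (η : E3)).comp (P.comp (fderiv ℝ h 0))) 0 :=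
    (innerSL ℝ (η : E3)).hasFDerivAt.comp (0 : ℝ × ℝ)
      (HasFDerivAt.comp (g := C.param) (0 : ℝ × ℝ) (by rw [hh.1]; exact C.hasFDerivAt_param) dh)
  have hL : HasStrictFDerivAt (fun X => inner ℝ (η : E3) (k X))
      ((innerSL ℝ (η : E3)).comp (fderiv ℝ k 0)) 0 :=
    (innerSL ℝ (η : E3)).hasStrictFDerivAt.comp (0 : E3) hk.2.1.hasStrictFDerivAt
  have hzero := fderiv_eq_zero_of_comp_crossCapModel_eq_sq hL dT
    (by simp only [T, hh.1, C.param_zero, inner_zero_right])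
    (by simp [P, hker]) (by
      filter_upwards [H] with z hz
      rw [hz]
      exact inner_foldingMap_zero η _)
  obtain ⟨v, hv⟩ := hk.fderiv_surjective (η : E3)
  have := DFunLike.congr_fun hzero v
  rw [ContinuousLinearMap.comp_apply, hv, innerSL_apply_apply, inner_self_of_mem_sphere] at this
  simp at this

end GeometricCrossCap

theorem proposition3p1 (C : GeometricCrossCap) (η : Metric.sphere (0 : E3) 1) (δ : ℝ) :
    IsSingularAt (C.folding η δ) 0 ∧
    (IsMoreDegenerateThanCrossCapAt (C.folding η δ) 0 ↔ (0 : E3) ∈ foldingPlane η δ) ∧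
    ((0 : E3) ∈ foldingPlane η δ ↔ δ = 0) := by
  have hplane : (0 : E3) ∈ foldingPlane η δ ↔ δ = 0 := by
    simp [foldingPlane, eq_comm]
  refine ⟨C.isSingularAt_folding η δ, ?_, hplane⟩
  rw [hplane]
  constructor
  · rintro ⟨-, h⟩
    by_contra hδ
    exact h (C.hasCrossCapAt_folding η δ hδ)
  · rintro rfl
    exact ⟨C.isSingularAt_folding η 0, C.not_hasCrossCapAt_folding_zero η⟩
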